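/- Setting and definitions. Let $p$ be a prime. For a finite totally ramified Galois extension $K/k$ of complete discrete valuation fields of residue characteristic $p$, with $G=\mathrm{Gal}(K/k)$ and $n=[K:k]$, let $v$ be the normalised valuation of $K$, $\mathfrak O$ its ring of integers, $\mathfrak m$ the maximal ideal of $\mathfrak O$, $\kappa$ the residue field, $r:\mathfrak O\to\kappa$ the reduction, $\pi$ a fixed uniformizing element, $\mathfrak D$ the different of $K/k$, and $d=v(\mathfrak D)-n+1$. An element $f=\sum_\sigma a_\sigma\sigma\in K[G]$ acts on $K$ by $f(x)=\sum_\sigma a_\sigma\sigma(x)$. For $i\in\mathbb Z$ put $\mathfrak C_i=\{f\in K[G]: v(f(x))\ge v(x)+i \text{ for all } x\in K^*\}$. For $0\neq f\in\mathfrak C_i\setminus\mathfrak C_{i+1}$ put $d(f)=i-d$ and $$\mathfrak p(f)=r(\mathrm{tr}_{K/k}(\pi^{-d}))^{-1}\sum_{j=0}^{n-1} r\bigl(f(\pi^{j-i})/\pi^j\bigr)X^j\in R=\kappa[X]/(X^n-1).$$ Let $k_0\subset k$ be a complete discrete valuation subfield such that $k/k_0$ is finite and totally ramified, $e_0=[K:k_0]$.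 For $B\subset K[G]\setminus\{0\}$ and $s\in\mathbb Z$ put $B_s^0=\{b\in B: d(b)\equiv s \bmod e_0\}$. - $B$ is *$k_0$-graded independent* if for each $s\in\mathbb Z$ the family $(\mathfrak p(b))_{b\in B_s^0}$ is linearly independent over $\kappa$; it is a *graded base* for $(K/k,k_0)$ if, moreover, the $k_0$-span of $B$ equals $k_0[G]$. - Let $\phi:K\otimes_kK\to K[G]$ be the bijection $x\otimes y\mapsto x\sum_{\sigma\in G}\sigma(y)\sigma$. For $(a,b),(a',b')\in\mathbb Z^2$ write $[(a,b)]\le[(a',b')]$ if $a\le a'+nc$ and $b\le b'-nc$ for some $c\in\mathbb Z$; this is a partial order on $\mathbb Z^2/\mathbb Z(n,-n)$. Each $\alpha\in K\otimes_kK$ can be written as a finite sum $\sum_{(i,j)\in T}\varepsilon_{ij}\,\pi^i\otimes\pi^j$, where all $\varepsilon_{ij}$ are units of $\mathfrak O\otimes\mathfrak O$ and the classes of distinct elements of $T$ are incomparable; the set $G(\alpha)$ of classes of elements of $T$ depends only on $\alpha$. The element $\phi(\alpha)$ is *diagonal* if $i+j$ is constant on $G(\alpha)$. - $B$ is *$k_0$-diagonal*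 if it is $k_0$-graded independent and for each $s\in\mathbb Z$ all non-zero $k_0$-linear combinations of elements of $B_s^0$ are diagonal. Theorem. Let $K'/k_0'$ be a totally ramified extension of complete discrete valuation fields of residue characteristic $p$ whose degree is a power of $p$, let $k_0'\subset k'\subset K'$ be an intermediate field such that $K'/k'$ is Galois of degree $n$ with group $G$, and let $k_0/k_0'$ be a finite tamely ramified extension with ramification index $e$ (so $p\nmid e$ and the residue field extension is separable; if $k_0/k_0'$ is totally ramified, then $e$ is its degree). Inside a composite field let $k=k_0k'$ and $K=k_0K'$. Fix uniformizing elements of $K'$ and of $K$. Then: 1. $K'/k_0'$ is linearly disjoint from $k_0/k_0'$; moreover, $K/k$ is Galois and restriction to $K'$ is an isomorphism $\mathrm{Gal}(K/k)\to G$. By means of this isomorphism we view subsets of $K'[G]$ as subsets of $K[G]$. 2. If $B\subset K'[G]$ is $k_0'$-graded independent, then $B$ is $k_0$-graded independent in $K[G]$. If $B$ is a graded base for $(K'/k',k_0')$, then $B$ is a graded base for $(K/k,k_0)$. 3. If $e\ge n-1$ and $B\subset K'[G]$ is $k_0'$-graded independent, then $B$ is $k_0$-diagonal in $K[G]$. 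-/

import Mathlib

open scoped WithZero TensorProduct Polynomial

noncomputable section

namespace TameLift

/-! ### Complete discrete valuation fields and their extensions

A discrete valuation is written multiplicatively, with values in `ℤᵐ⁰`: the element `x` has additive
valuation `i` when `v x = WithZero.exp (-i)`. It is normalised when `v` is surjective. -/

/-- `F` is a complete discrete valuation field with normalised valuation `v`. -/
structure IsCompleteDVF {F : Type*} [Field F] (v : Valuation F ℤᵐ⁰) : Prop where
  surjective : Function.Surjective v
  complete : IsAdicComplete (IsLocalRing.maximalIdeal v.valuationSubring) v.valuationSubring

/-- The normalised valuation `w` of `L` extends the normalised valuation `v` of `F`,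
with ramification index `e`. -/
def HasRamificationIndex {F L : Type*} [Field F] [Field L] [Algebra F L]
    (v : Valuation F ℤᵐ⁰) (w : Valuation L ℤᵐ⁰) (e : ℕ) : Prop :=
  0 < e ∧ ∀ x : F, w (algebraMap F L x) = v x ^ e

/-- `L/F` is a finite totally ramified extension: its ramification index is its degree. -/
def IsTotallyRamified {F L : Type*} [Field F] [Field L] [Algebra F L]
    (v : Valuation F ℤᵐ⁰) (w : Valuation L ℤᵐ⁰) : Prop :=
  FiniteDimensional F L ∧ HasRamificationIndex v w (Module.finrank F L)

/-- `L/F` is a finite tamely ramified extension of ramification index `e`, where `p` is the residue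
characteristic: `p ∤ e`, and the extension of residue fields is separable. -/
def IsTamelyRamified {F L : Type*} [Field F] [Field L] [Algebra F L]
    (p : ℕ) (v : Valuation F ℤᵐ⁰) (w : Valuation L ℤᵐ⁰) [v.HasExtension w] (e : ℕ) : Prop :=
  FiniteDimensional F L ∧ HasRamificationIndex v w e ∧ ¬ p ∣ e ∧
    Algebra.IsSeparable (IsLocalRing.ResidueField v.valuationSubring)
      (IsLocalRing.ResidueField w.valuationSubring)

/-- `ϖ` is a uniformizing element. -/
def IsUnif {F : Type*} [Field F] (v : Valuation F ℤᵐ⁰) (ϖ : F) : Prop :=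
  v ϖ = WithZero.exp (-1 : ℤ)

/-- The residue field. -/
abbrev Res {F : Type*} [Field F] (v : Valuation F ℤᵐ⁰) : Type _ :=
  IsLocalRing.ResidueField v.valuationSubring

open Classical in
/-- The reduction of integral elements to the residue field
(with value `0` outside of the ring of integers). -/
def red {F : Type*} [Field F] (v : Valuation F ℤᵐ⁰) (x : F) : Res v :=
  if h : x ∈ v.valuationSubring then IsLocalRing.residue v.valuationSubring ⟨x, h⟩ else 0

section Extension

variable (k : Type*) {K : Type*} [Field k] [Field K] [Algebra k K] (v : Valuation K ℤᵐ⁰)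

/-- The (additive) valuation of the different of `K/k`: the inverse different is the largest
fractional ideal `𝔪 ^ (-m)` all of whose elements have integral trace. -/
def differentVal : ℤ :=
  sSup {m : ℤ | ∀ x : K, v x ≤ WithZero.exp m → v (algebraMap k K (Algebra.trace k K x)) ≤ 1}

/-- The ramification depth `d = v(𝔇) - n + 1` of `K/k`, where `n = [K : k]`. -/
def depth : ℤ := differentVal k v - Module.finrank k K + 1

/-- The group algebra `K[G]`, where `G = Gal(K/k)`. -/
abbrev GrpAlg (k K : Type*) [Field k] [Field K] [Algebra k K] : Type _ :=
  MonoidAlgebra K (K ≃ₐ[k] K)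

variable {k}

/-- The action of `K[G]` on `K`: the element `∑ a_σ σ` sends `x` to `∑ a_σ σ(x)`. -/
def act (f : GrpAlg k K) (x : K) : K := f.coeff.sum fun σ a => a * σ x

/-- `𝔠_i`: the elements of `K[G]` that increase valuations at least by `i`. -/
def filt (i : ℤ) : Set (GrpAlg k K) :=
  {f | ∀ x : K, x ≠ 0 → v (act f x) ≤ v x * WithZero.exp (-i)}

/-- For `f ≠ 0`, the integer `i` such that `f ∈ 𝔠_i` and `f ∉ 𝔠_{i+1}`. -/
def level (f : GrpAlg k K) : ℤ := sSup {i : ℤ | f ∈ filt v i}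

/-- The function `d(f)`: for `f ≠ 0` we have `d(f) = i` when `f ∈ 𝔠_{i+d}` and
`f ∉ 𝔠_{i+d+1}`. -/
def dFun (f : GrpAlg k K) : ℤ := level v f - depth k v

variable (k) in
/-- The ring `R = κ[X]/(X^n - 1)`, where `κ` is the residue field of `K` and `n = [K : k]`. -/
abbrev QuotRing : Type _ :=
  AdjoinRoot ((Polynomial.X : (Res v)[X]) ^ Module.finrank k K - 1)

variable (k) in
/-- The element `tr(π^{-d})`, a unit of the ring of integers. -/
def traceUnit (ϖ : K) : K := algebraMap k K (Algebra.trace k K (ϖ ^ (-depth k v)))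

/-- `p_i(f) = r(tr(π^{-d}))⁻¹ ∑_{0 ≤ j < n} r(f(π^{j-i}) / π^j) X^j`, for `f ∈ 𝔠_i`. -/
def gradedPiece (ϖ : K) (i : ℤ) (f : GrpAlg k K) : QuotRing k v :=
  (red v (traceUnit k v ϖ))⁻¹ • ∑ j ∈ Finset.range (Module.finrank k K),
    red v (act f (ϖ ^ ((j : ℤ) - i)) / ϖ ^ j) • AdjoinRoot.root _ ^ j

/-- The function `𝔭(f) = p_i(f)`, where `f ∈ 𝔠_i` and `f ∉ 𝔠_{i+1}`, for `f ≠ 0`. -/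
def gp (ϖ : K) (f : GrpAlg k K) : QuotRing k v := gradedPiece v ϖ (level v f) f

variable (k₀ : Type*) [Field k₀] [Algebra k₀ K]

/-- `B_s^0`: the elements `f` of `B` with `d(f) ≡ s` modulo `e₀ = [K : k₀]`. -/
def residueClass (B : Set (GrpAlg k K)) (s : ℤ) : Set (GrpAlg k K) :=
  {f ∈ B | dFun v f ≡ s [ZMOD (Module.finrank k₀ K : ℤ)]}

/-- `B ⊆ K[G] ∖ {0}` is `k₀`-graded independent: for each `s` the family of all `𝔭(b)`,
`b ∈ B_s^0`, is linearly independent over the residue field. -/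
def IsGradedIndependent (ϖ : K) (B : Set (GrpAlg k K)) : Prop :=
  (0 : GrpAlg k K) ∉ B ∧
    ∀ s : ℤ, LinearIndependent (Res v) fun b : residueClass v k₀ B s => gp v ϖ (b : GrpAlg k K)

/-- The elements of `k₀[G] ⊆ K[G]`. -/
def baseGrpAlg : Set (GrpAlg k K) :=
  {f | ∀ σ, f.coeff σ ∈ Set.range (algebraMap k₀ K)}

/-- `B` is a graded base for `(K/k, k₀)`: it is `k₀`-graded independent and generates `k₀[G]` as a
`k₀`-module. -/
def IsGradedBase (ϖ : K) (B : Set (GrpAlg k K)) : Prop :=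
  IsGradedIndependent v k₀ ϖ B ∧
    (Submodule.span k₀ B : Set (GrpAlg k K)) = baseGrpAlg k₀

/-! ### Diagonal elements -/

variable (k) in
/-- The image of `𝔒 ⊗ 𝔒` in `K ⊗ K`, where `𝔒` is the ring of integers of `K`. -/
def intTensor : Subring (K ⊗[k] K) :=
  Subring.closure {z | ∃ x y : K, v x ≤ 1 ∧ v y ≤ 1 ∧ z = x ⊗ₜ[k] y}

/-- The order on `ℤ²` modulo `(n, -n)`, on representatives: the class of `a` is at most the class
of `b` when `a` is coordinatewise at most some representative of the class of `b`. -/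
def classLE (n : ℕ) (a b : ℤ × ℤ) : Prop :=
  ∃ c : ℤ, a.1 ≤ b.1 + n * c ∧ a.2 ≤ b.2 - n * c

/-- `α = ∑_{(i,j) ∈ T} ε_{ij} (π^i ⊗ π^j)` with all `ε_{ij}` invertible in `𝔒 ⊗ 𝔒`, and the images
of distinct elements of `T` in `ℤ²` modulo `(n, -n)` are incomparable; that is, `T` is a set of
representatives for `G(α)`. -/
def IsSupport (ϖ : K) (α : K ⊗[k] K) (T : Finset (ℤ × ℤ)) : Prop :=
  (∀ a ∈ T, ∀ b ∈ T, a ≠ b → ¬ classLE (Module.finrank k K) a b) ∧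
    ∃ ε : ℤ × ℤ → K ⊗[k] K,
      (∀ a ∈ T, ε a ∈ intTensor k v ∧ ∃ η ∈ intTensor k v, ε a * η = 1) ∧
      α = ∑ a ∈ T, ε a * ((ϖ ^ a.1) ⊗ₜ[k] (ϖ ^ a.2))

/-- `α ∈ K ⊗ K` is diagonal: `i + j` is constant on `G(α)`. -/
def IsDiagonalTensor (ϖ : K) (α : K ⊗[k] K) : Prop :=
  ∃ T : Finset (ℤ × ℤ), IsSupport v ϖ α T ∧ ∃ s : ℤ, ∀ a ∈ T, a.1 + a.2 = s

/-- The coefficient at `σ` of the isomorphism `φ : K ⊗ K → K[G]`,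
`φ(x ⊗ y) = x ∑_σ σ(y) σ`. -/
def phiCoeff (σ : K ≃ₐ[k] K) : K ⊗[k] K →ₐ[k] K :=
  Algebra.TensorProduct.lift (AlgHom.id k K) (σ : K →ₐ[k] K) fun _ _ => Commute.all _ _

/-- `f ∈ K[G]` is diagonal: `f = φ(α)` for a diagonal `α`. -/
def IsDiagonal (ϖ : K) (f : GrpAlg k K) : Prop :=
  ∃ α : K ⊗[k] K, (∀ σ, f.coeff σ = phiCoeff σ α) ∧ IsDiagonalTensor v ϖ α

/-- `B ⊆ K[G] ∖ {0}` is `k₀`-diagonal: it is `k₀`-graded independent, and for each `s` all non-zero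
`k₀`-linear combinations of elements of `B_s^0` are diagonal. -/
def IsDiagonalSet (ϖ : K) (B : Set (GrpAlg k K)) : Prop :=
  IsGradedIndependent v k₀ ϖ B ∧
    ∀ s : ℤ, ∀ f ∈ Submodule.span k₀ (residueClass v k₀ B s), f ≠ 0 → IsDiagonal v ϖ f

end Extension

section BaseChange

variable {k' K' k K : Type*} [Field k'] [Field K'] [Field k] [Field K]
  [Algebra k' K'] [Algebra k' k] [Algebra k K] [Algebra k' K] [Algebra K' K]
  [IsScalarTower k' k K] [IsScalarTower k' K' K] [Normal k' K']

variable (k' K') in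
/-- The restriction of automorphisms `Gal(K/k) → Gal(K'/k')`. -/
def restrictGal (τ : K ≃ₐ[k] K) : K' ≃ₐ[k'] K' :=
  (τ.restrictScalars k').restrictNormal K'

variable (k K) in
/-- A set `B ⊆ K'[Gal(K'/k')]`, considered as a set in `K[Gal(K/k)]` by means of the restriction
`Gal(K/k) → Gal(K'/k')`. -/
def baseChange (B : Set (GrpAlg k' K')) : Set (GrpAlg k K) :=
  {f | ∃ b ∈ B, ∀ τ : K ≃ₐ[k] K, f.coeff τ = algebraMap K' K (b.coeff (restrictGal k' K' τ))}

end BaseChange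

end TameLift

end

/-! Additive values are used in this outline; in the code a value `i` appears as `exp (-i)`. Put `n
= [K : k]` and `N = [K : k₀]`.

Everything is read off from coordinates. If `θ ∈ K` has value `e` prime to `n`, the powers `θ ^ j`,
`j < n`, form a basis of `K/k`, and every `f ∈ K[G]` is the image of a unique `∑ z_j ⊗ θ ^ j`; it
acts by `x ↦ ∑ z_j tr(θ ^ j x)`. The trace raises values by at least `d`, and by exactly `d` when
`n` divides `v(x) + d`. Hence `d(f)` is the minimum `s` of the values of the `z_j θ ^ j`, and `𝔭(f)`
has the coefficients `r(z_j θ ^ j / π ^ s)` at distinct powers of `X` that depend only on `s` modulo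
`n` (`level_eq`, `gp_eq_sum`). Independence of leading terms is thus independence of vectors of
reductions (`linearIndependent_gp_iff`).

Uniqueness of the extension of a complete valuation and `p ∤ e` show that `K/k₀` is totally ramified
of degree `N = [K' : k₀']` and that `K/K'` has ramification index `e` (`tame_composite`). Take for
`θ` the uniformizer of `K'`. Coordinates of `b` over `K'` remain coordinates over `K`, `d(b)` is
multiplied by `e`, which is invertible modulo `N`, and the vectors of reductions change only by an
extension of the residue field and nonzero factors. So graded independence survives.

For diagonality, consider a coordinate of a `k₀`-combination of elements of one residue class. After
division by a power of `θ` it is an element of `k₀` plus an error at least `e` above the expected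
minimal value. Values of `k₀` are multiples of `N`, so a coordinate is either minimal or at least
`min(e, N) ≥ n - 1` above the minimum (`val_sum_gap`); independence ensures that the minimum occurs.
Pure tensors of total value at least `n - 1` lie in `𝔒 ⊗ 𝔒`, so all nonminimal terms can be absorbed
into the unit coefficient of one minimal term (`isDiagonal_of_gap`). -/

namespace TameLift

open WithZero

/-! ### Uniqueness of the extension of a complete discrete valuation -/

section Uniqueness

lemma exp_log_of_val_ne {F : Type*} [Field F] (w : Valuation F ℤᵐ⁰) {x : F} (hx : x ≠ 0) :
    w x = exp (log (w x)) :=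
  (exp_log (w.ne_zero_iff.2 hx)).symm

/-- The real absolute value `2 ^ (log (w x) / c)` attached to a valuation. -/
noncomputable def realAbs {L : Type*} [Field L] (w : Valuation L ℤᵐ⁰) (c : ℝ) (x : L) : ℝ :=
  open Classical in if x = 0 then 0 else (2 : ℝ) ^ (((log (w x) : ℤ) : ℝ) / c)

variable {L : Type*} [Field L] (w : Valuation L ℤᵐ⁰) {c : ℝ}

lemma realAbs_zero : realAbs w c 0 = 0 := by simp [realAbs]

lemma realAbs_of_ne {x : L} (hx : x ≠ 0) : realAbs w c x = (2 : ℝ) ^ (((log (w x) : ℤ) : ℝ) / c) := by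
  simp [realAbs, hx]

lemma realAbs_nonneg (x : L) : 0 ≤ realAbs w c x := by
  unfold realAbs
  split_ifs
  · rfl
  · positivity

lemma realAbs_le_iff (hc : 0 < c) {x y : L} : realAbs w c x ≤ realAbs w c y ↔ w x ≤ w y := by
  rcases eq_or_ne x 0 with rfl | hx
  · simp [realAbs_zero, realAbs_nonneg]
  rcases eq_or_ne y 0 with rfl | hy
  · have : 0 < realAbs w c x := by rw [realAbs_of_ne w hx]; positivity
    simp [realAbs_zero, hx, this.not_ge]
  rw [realAbs_of_ne w hx, realAbs_of_ne w hy, Real.rpow_le_rpow_left_iff (by norm_num),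
    div_le_div_iff_of_pos_right hc, Int.cast_le,
    log_le_log (w.ne_zero_iff.2 hx) (w.ne_zero_iff.2 hy)]

lemma realAbs_add_le_max (hc : 0 < c) (x y : L) :
    realAbs w c (x + y) ≤ max (realAbs w c x) (realAbs w c y) := by
  rw [le_max_iff, realAbs_le_iff w hc, realAbs_le_iff w hc, ← le_max_iff]
  exact w.map_add x y

/-- The function `realAbs` as an absolute value. -/
noncomputable def realAbsoluteValue (c : ℝ) (hc : 0 < c) : AbsoluteValue L ℝ where
  toFun := realAbs w c
  map_mul' x y := by
    rcases eq_or_ne x 0 with rfl | hx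
    · simp [realAbs_zero]
    rcases eq_or_ne y 0 with rfl | hy
    · simp [realAbs_zero]
    rw [realAbs_of_ne w hx, realAbs_of_ne w hy, realAbs_of_ne w (mul_ne_zero hx hy), map_mul,
      log_mul (w.ne_zero_iff.2 hx) (w.ne_zero_iff.2 hy), ← Real.rpow_add (by norm_num)]
    push_cast
    rw [add_div]
  nonneg' := realAbs_nonneg w
  eq_zero' x := by
    refine ⟨fun h => ?_, fun h => by simp [h, realAbs_zero]⟩
    by_contra hx
    rw [realAbs_of_ne w hx] at h
    exact (Real.rpow_pos_of_pos two_pos _).ne' h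
  add_le' x y := (realAbs_add_le_max w hc x y).trans
    (max_le_add_of_nonneg (realAbs_nonneg w x) (realAbs_nonneg w y))

end Uniqueness

section Complete

variable {F : Type*} [Field F] {v : Valuation F ℤᵐ⁰}

lemma exists_isUnif (hv : Function.Surjective v) : ∃ ϖ, IsUnif v ϖ := hv _

lemma IsUnif.ne_zero {ϖ : F} (h : IsUnif v ϖ) : ϖ ≠ 0 := by
  rintro rfl
  rw [IsUnif, map_zero] at h
  exact exp_ne_zero h.symm

lemma IsUnif.val_zpow {ϖ : F} (h : IsUnif v ϖ) (i : ℤ) : v (ϖ ^ i) = exp (-i) := by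
  rw [map_zpow₀, h, ← exp_zsmul]
  simp

lemma lt_exp_iff {x : ℤᵐ⁰} {i : ℤ} : x < exp i ↔ x ≤ exp (i - 1) := by
  rcases eq_or_ne x 0 with rfl | hx
  · simp
  · rw [← exp_log hx, exp_lt_exp, exp_le_exp]
    omega

lemma mem_maximalIdeal_pow_iff {ϖ : F} (h : IsUnif v ϖ) (m : ℕ) (x : v.valuationSubring) :
    x ∈ IsLocalRing.maximalIdeal v.valuationSubring ^ m ↔ v x ≤ exp (-(m : ℤ)) := by
  have hϖ : ϖ ∈ v.valuationSubring := by
    rw [Valuation.mem_valuationSubring_iff, h, ← exp_zero, exp_le_exp]; norm_num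
  have key : ∀ (m : ℕ) (x : v.valuationSubring),
      x ∈ Ideal.span {(⟨ϖ, hϖ⟩ : v.valuationSubring) ^ m} ↔ v x ≤ exp (-(m : ℤ)) := by
    intro m x
    rw [Ideal.mem_span_singleton]
    have hm : v (ϖ ^ m) = exp (-(m : ℤ)) := by
      simpa using h.val_zpow m
    constructor
    · rintro ⟨y, rfl⟩
      have : v (y : F) ≤ 1 := y.2
      push_cast
      rw [map_mul, hm]
      exact mul_le_of_le_one_right' this
    · intro hx
      refine ⟨⟨x * (ϖ ^ m)⁻¹, ?_⟩, ?_⟩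
      · rw [Valuation.mem_valuationSubring_iff, map_mul, map_inv₀, hm]
        calc v x * (exp (-(m : ℤ)))⁻¹ ≤ exp (-(m : ℤ)) * (exp (-(m : ℤ)))⁻¹ := by gcongr
          _ = 1 := mul_inv_cancel₀ exp_ne_zero
      · ext
        push_cast
        have := pow_ne_zero m h.ne_zero
        field_simp
  have h1 : IsLocalRing.maximalIdeal v.valuationSubring
      = Ideal.span {(⟨ϖ, hϖ⟩ : v.valuationSubring)} := by
    ext x
    have := key 1 x
    rw [pow_one] at this
    rw [this, Valuation.mem_maximalIdeal_iff, ← exp_zero, lt_exp_iff]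
    simp
  rw [h1, Ideal.span_singleton_pow, key]

/-- Adic completeness concerns sequences in the ring of integers with prescribed congruences. The
sequence is therefore thinned out along the monotone `N'` and shifted into the ring by subtracting
one of its terms. -/
lemma exists_limit_of_cauchy (hv : IsCompleteDVF v) (u : ℕ → F)
    (hu : ∀ m : ℕ, ∃ N, ∀ a ≥ N, ∀ b ≥ N, v (u a - u b) ≤ exp (-(m : ℤ))) :
    ∃ l, ∀ m : ℕ, ∃ N, ∀ a ≥ N, v (u a - l) ≤ exp (-(m : ℤ)) := by
  obtain ⟨ϖ, hϖ⟩ := exists_isUnif hv.surjective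
  choose N hN using hu
  let N' : ℕ → ℕ := fun m => (Finset.range (m + 1)).sup N
  have hN' : ∀ m, N m ≤ N' m := fun m => Finset.le_sup (f := N) (by simp)
  have hmono : Monotone N' := fun a b h => Finset.sup_mono (by
    intro x; simp only [Finset.mem_range]; omega)
  have hle : ∀ m, u (N' m) - u (N' 0) ∈ v.valuationSubring := by
    intro m
    rw [Valuation.mem_valuationSubring_iff]
    simpa using hN 0 (N' m) ((hN' 0).trans (hmono (Nat.zero_le _))) (N' 0) (hN' 0)
  obtain ⟨l, hl⟩ := hv.complete.toIsPrecomplete.prec (f := fun m => ⟨_, hle m⟩) (by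
    intro m m' h
    rw [SModEq.sub_mem, smul_eq_mul, Ideal.mul_top, mem_maximalIdeal_pow_iff hϖ]
    push_cast
    rw [sub_sub_sub_cancel_right]
    exact hN m _ (hN' m) _ ((hN' m).trans (hmono h)))
  refine ⟨l + u (N' 0), fun m => ⟨N m, fun a ha => ?_⟩⟩
  have h1 := hl m
  rw [SModEq.sub_mem, smul_eq_mul, Ideal.mul_top, mem_maximalIdeal_pow_iff hϖ] at h1
  push_cast at h1
  have h2 := hN m a ha _ (hN' m)
  have : u a - (l + u (N' 0)) = (u a - u (N' m)) + (u (N' m) - u (N' 0) - l) := by ring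
  rw [this]
  exact v.map_add_le h2 h1

/-- Two valuations of a finite extension of a complete discrete valuation field that extend its
valuation agree up to normalisation. -/
theorem val_pow_eq_of_extends (hv : IsCompleteDVF v) {L : Type*} [Field L] [Algebra F L]
    [FiniteDimensional F L] {w₁ w₂ : Valuation L ℤᵐ⁰} {e₁ e₂ : ℕ}
    (h₁ : HasRamificationIndex v w₁ e₁) (h₂ : HasRamificationIndex v w₂ e₂) (x : L) :
    w₁ x ^ e₂ = w₂ x ^ e₁ := by
  rcases eq_or_ne x 0 with rfl | hx
  · rw [map_zero, map_zero, zero_pow h₂.1.ne', zero_pow h₁.1.ne']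
  let A : AbsoluteValue F ℝ := realAbsoluteValue v 1 one_pos
  have hA : ∀ a, A a = realAbs v 1 a := fun _ => rfl
  let _ : NormedField F := A.toNormedField
  have hnorm : ∀ a : F, ‖a‖ = realAbs v 1 a := fun _ => rfl
  obtain ⟨ϖ, hϖ⟩ := exists_isUnif hv.surjective
  have h2 : ‖ϖ‖ ≠ 1 := by
    rw [hnorm, realAbs_of_ne _ hϖ.ne_zero, hϖ, log_exp]
    norm_num
  let _ : NontriviallyNormedField F :=
    NontriviallyNormedField.ofNormNeOne ⟨ϖ, hϖ.ne_zero, h2⟩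
  have _ : IsUltrametricDist F := IsUltrametricDist.isUltrametricDist_of_forall_norm_add_le_max_norm
    (fun a b => realAbs_add_le_max v one_pos a b)
  have hle : ∀ (a : F) (m : ℕ), ‖a‖ ≤ (2 : ℝ)⁻¹ ^ m ↔ v a ≤ exp (-(m : ℤ)) := by
    intro a m
    have h1 : v (ϖ ^ m) = exp (-(m : ℤ)) := by simpa using hϖ.val_zpow m
    rw [← h1, ← realAbs_le_iff v one_pos, hnorm, realAbs_of_ne v (pow_ne_zero m hϖ.ne_zero), h1,
      log_exp]
    simp [Real.rpow_neg]
  have _ : CompleteSpace F := by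
    refine Metric.complete_of_cauchySeq_tendsto fun u hu => ?_
    rw [Metric.cauchySeq_iff] at hu
    obtain ⟨l, hl⟩ := exists_limit_of_cauchy hv u (fun m => by
      obtain ⟨N, hN⟩ := hu ((2 : ℝ)⁻¹ ^ m) (by positivity)
      refine ⟨N, fun a ha b hb => ?_⟩
      rw [← hle, ← dist_eq_norm]
      exact (hN a ha b hb).le)
    refine ⟨l, Metric.tendsto_atTop.2 fun ε hε => ?_⟩
    obtain ⟨m, hm⟩ := exists_pow_lt_of_lt_one hε (by norm_num : (2 : ℝ)⁻¹ < 1)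
    obtain ⟨N, hN⟩ := hl m
    refine ⟨N, fun a ha => lt_of_le_of_lt ?_ hm⟩
    rw [dist_eq_norm, hle]
    exact hN a ha
  -- Division of the exponent by `e` makes `realAbs w e` restrict to the fixed absolute value of
  -- `F`. Over a complete ultrametric field such a multiplicative extension is unique, hence equal
  -- to the spectral norm.
  have key : ∀ {w : Valuation L ℤᵐ⁰} {e : ℕ}, HasRamificationIndex v w e →
      realAbs w e x = spectralNorm F L x := by
    intro w e h
    have he : (0 : ℝ) < e := by exact_mod_cast h.1
    refine spectralNorm_unique_field_norm_ext (f := realAbsoluteValue w e he) (fun a => ?_) x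
    change realAbs w e _ = realAbs v 1 a
    rcases eq_or_ne a 0 with rfl | ha
    · simp [realAbs_zero]
    rw [realAbs_of_ne v ha, realAbs_of_ne w (by simpa using ha), h.2, log_pow]
    congr 1
    push_cast [nsmul_eq_mul]
    field_simp
  have h3 := (key h₁).trans (key h₂).symm
  rw [realAbs_of_ne _ hx, realAbs_of_ne _ hx] at h3
  have h4 := Real.rpow_right_inj (by norm_num) (by norm_num) |>.1 h3
  have he₁ : (e₁ : ℝ) ≠ 0 := by exact_mod_cast h₁.1.ne'
  have he₂ : (e₂ : ℝ) ≠ 0 := by exact_mod_cast h₂.1.ne'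
  rw [div_eq_div_iff he₁ he₂] at h4
  have h5 : log (w₁ x) * e₂ = log (w₂ x) * e₁ := by exact_mod_cast h4
  rw [exp_log_of_val_ne w₁ hx, exp_log_of_val_ne w₂ hx, ← exp_nsmul, ← exp_nsmul, exp_inj]
  simp only [nsmul_eq_mul]
  linarith

end Complete

/-! ### Value groups -/

section ValueGroups

/-- Nonzero terms of distinct values cannot cancel: the sum has the value of its largest term. -/
lemma val_le_val_sum {L ι : Type*} [Field L] (w : Valuation L ℤᵐ⁰) (s : Finset ι) (y : ι → L)
    (h : ∀ i ∈ s, ∀ j ∈ s, i ≠ j → y i ≠ 0 → w (y i) ≠ w (y j)) :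
    ∀ i ∈ s, w (y i) ≤ w (∑ i ∈ s, y i) := by
  classical
  intro i hi
  obtain ⟨j, hj, hmax⟩ := s.exists_max_image (fun i => w (y i)) ⟨i, hi⟩
  rcases eq_or_ne (y j) 0 with h0 | h0
  · have := hmax i hi
    rw [h0, map_zero] at this
    exact this.trans zero_le
  · rw [w.map_sum_eq_of_lt hj]
    · exact hmax i hi
    · intro l hl
      rw [Finset.mem_sdiff, Finset.mem_singleton] at hl
      exact lt_of_le_of_ne (hmax l hl.1) (h j hj l hl.1 (Ne.symm hl.2) h0).symm

/-- The group of (logarithmic) values that `w` takes on the nonzero elements of `F`. -/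
def valGroup (F : Type*) {L : Type*} [Field F] [Field L] [Algebra F L] (w : Valuation L ℤᵐ⁰) :
    AddSubgroup ℤ where
  carrier := {i | ∃ a : F, w (algebraMap F L a) = exp i}
  add_mem' := by
    rintro i j ⟨a, ha⟩ ⟨b, hb⟩
    exact ⟨a * b, by rw [map_mul, map_mul, ha, hb, exp_add]⟩
  zero_mem' := ⟨1, by simp⟩
  neg_mem' := by
    rintro i ⟨a, ha⟩
    exact ⟨a⁻¹, by rw [map_inv₀, map_inv₀, ha, exp_neg]⟩

lemma mem_valGroup {F L : Type*} [Field F] [Field L] [Algebra F L] {w : Valuation L ℤᵐ⁰} {i : ℤ} :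
    i ∈ valGroup F w ↔ ∃ a : F, w (algebraMap F L a) = exp i := Iff.rfl

lemma log_mem_valGroup {F L : Type*} [Field F] [Field L] [Algebra F L] (w : Valuation L ℤᵐ⁰) {a : F}
    (ha : a ≠ 0) : log (w (algebraMap F L a)) ∈ valGroup F w :=
  ⟨a, exp_log_of_val_ne w (by simpa using ha)⟩

variable {F M L : Type*} [Field F] [Field M] [Field L] [Algebra F M] [Algebra M L] [Algebra F L]
  [IsScalarTower F M L] {w : Valuation L ℤᵐ⁰}

lemma valGroup_le : valGroup F w ≤ valGroup M w := by
  rintro i ⟨a, ha⟩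
  exact ⟨algebraMap F M a, by rwa [← IsScalarTower.algebraMap_apply]⟩

/-- Nonzero `F`-multiples of the `x i` have values in different cosets of the value group of `F`, so
no cancellation can occur in a linear relation. -/
lemma linearIndependent_of_val {ι : Type*} (x : ι → M) (t : ι → ℤ)
    (ht : ∀ i, w (algebraMap M L (x i)) = exp (t i))
    (h : ∀ i j, t i - t j ∈ valGroup F w → i = j) : LinearIndependent F x := by
  rw [linearIndependent_iff']
  intro s g hg i hi
  have hv : ∀ i, g i ≠ 0 → w (algebraMap M L (g i • x i))
      = exp (log (w (algebraMap F L (g i))) + t i) := by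
    intro i hgi
    rw [Algebra.smul_def, map_mul, map_mul, ht, ← IsScalarTower.algebraMap_apply, exp_add,
      exp_log]
    rw [Valuation.ne_zero_iff]
    simpa using hgi
  have := val_le_val_sum w s (fun i => algebraMap M L (g i • x i)) (by
    intro i hi j hj hij h0 heq
    have hgi : g i ≠ 0 := by
      rintro h1
      simp [h1] at h0
    have hgj : g j ≠ 0 := by
      rintro h1
      rw [h1, zero_smul, map_zero, map_zero, hv i hgi] at heq
      exact exp_ne_zero heq
    rw [hv i hgi, hv j hgj, exp_inj] at heq
    apply hij
    apply h
    have : t i - t j = log (w (algebraMap F L (g j))) - log (w (algebraMap F L (g i))) := by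
      linarith
    rw [this]
    exact sub_mem (log_mem_valGroup w hgj) (log_mem_valGroup w hgi)) i hi
  rw [← map_sum, hg, map_zero, map_zero, le_zero_iff] at this
  by_contra hgi
  rw [hv i hgi] at this
  exact exp_ne_zero this

/-- Elements whose values represent the cosets are linearly independent. -/
lemma relIndex_valGroup_le [FiniteDimensional F M] :
    (valGroup F w).relIndex (valGroup M w) ≤ Module.finrank F M := by
  rw [AddSubgroup.relIndex, AddSubgroup.index]
  have hx : ∀ q : valGroup M w ⧸ (valGroup F w).addSubgroupOf (valGroup M w),
      ∃ a : M, w (algebraMap M L a) = exp ((q.out : valGroup M w) : ℤ) := fun q => q.out.2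
  choose x hx using hx
  have hli : LinearIndependent F x := linearIndependent_of_val x _ hx (by
    intro i j h
    rw [← Quotient.out_eq' i, ← Quotient.out_eq' j]
    refine (Quotient.sound' ?_)
    rw [QuotientAddGroup.leftRel_apply, AddSubgroup.mem_addSubgroupOf]
    have := neg_mem h
    simp only [neg_sub] at this
    simpa [sub_eq_neg_add] using this)
  have := hli.finite
  have := Fintype.ofFinite (valGroup M w ⧸ (valGroup F w).addSubgroupOf (valGroup M w))
  rw [Nat.card_eq_fintype_card]
  exact hli.fintype_card_le_finrank

lemma valGroup_self (hw : Function.Surjective w) : valGroup L w = ⊤ := by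
  ext i
  simpa [mem_valGroup] using hw (exp i)

lemma index_valGroup_le [FiniteDimensional M L] (hw : Function.Surjective w) :
    (valGroup M w).index ≤ Module.finrank M L := by
  have := relIndex_valGroup_le (F := M) (M := L) (w := w)
  rwa [valGroup_self hw, AddSubgroup.relIndex_top_right] at this

lemma eq_zmultiples_of_index (H : AddSubgroup ℤ) : H = AddSubgroup.zmultiples (H.index : ℤ) := by
  obtain ⟨a, rfl⟩ := Int.subgroup_cyclic H
  rw [show AddSubgroup.closure {a} = AddSubgroup.zmultiples a from
    (AddSubgroup.zmultiples_eq_closure a).symm, Int.index_zmultiples]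
  rcases Int.natAbs_eq a with h | h
  · rw [← h]
  · conv_lhs => rw [h, AddSubgroup.zmultiples_neg]

/-- If the top of a tower is totally ramified over the bottom, then it is totally ramified over
every intermediate field. -/
lemma valGroup_eq_zmultiples_of_tower [FiniteDimensional F L] [FiniteDimensional F M]
    [FiniteDimensional M L]
    (hw : Function.Surjective w)
    (h : valGroup F w = AddSubgroup.zmultiples (Module.finrank F L : ℤ)) :
    valGroup M w = AddSubgroup.zmultiples (Module.finrank M L : ℤ) := by
  have h1 := relIndex_valGroup_le (F := F) (M := M) (w := w)
  have h2 := index_valGroup_le (M := M) hw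
  have h3 := AddSubgroup.relIndex_mul_index (valGroup_le (F := F) (M := M) (w := w))
  have h4 := Module.finrank_mul_finrank F M L
  have h5 : (valGroup F w).index = Module.finrank F L := by
    rw [h]; simp
  have h6 : 0 < Module.finrank F M := Module.finrank_pos
  -- Indices and degrees both multiply along the tower, and each index is at most the corresponding
  -- degree; equality for the product forces equality for the factors.
  rw [eq_zmultiples_of_index (valGroup M w)]
  congr 2
  rw [h5, ← h4] at h3
  refine le_antisymm h2 ?_
  by_contra hlt
  push Not at hlt
  have := Nat.mul_lt_mul_of_le_of_lt h1 hlt h6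
  omega

end ValueGroups

/-! ### Composite fields -/

section Composite

variable {F' E F K : Type*} [Field F'] [Field E] [Field F] [Field K]
    [Algebra F' E] [Algebra F' F] [Algebra F K] [Algebra E K] [Algebra F' K]
    [IsScalarTower F' E K] [IsScalarTower F' F K]

variable (F' E F K) in
/-- The product map from the tensor product of two fields to their composite. -/
noncomputable def compositeMap : F ⊗[F'] E →ₐ[F] K :=
  Algebra.TensorProduct.lift (Algebra.ofId F K) (IsScalarTower.toAlgHom F' E K)
    fun _ _ => Commute.all _ _

lemma compositeMap_tmul (x : F) (y : E) :
    compositeMap F' E F K (x ⊗ₜ y) = algebraMap F K x * algebraMap E K y := by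
  simp [compositeMap, Algebra.ofId_apply]

lemma algebraAdjoin_eq_top [Algebra.IsAlgebraic F' E]
    (h : IntermediateField.adjoin F (Set.range (algebraMap E K)) = ⊤) :
    Algebra.adjoin F (Set.range (algebraMap E K)) = ⊤ := by
  have h1 := IntermediateField.adjoin_toSubalgebra_of_isAlgebraic (F := F)
    (S := Set.range (algebraMap E K)) (by
      rintro _ ⟨x, rfl⟩
      have h2 : IsIntegral F' x := Algebra.IsIntegral.isIntegral x
      exact ((h2.map (IsScalarTower.toAlgHom F' E K)).tower_top (A := F)).isAlgebraic)
  rw [← h1, h, IntermediateField.top_toSubalgebra]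

lemma compositeMap_surjective [Algebra.IsAlgebraic F' E]
    (h : IntermediateField.adjoin F (Set.range (algebraMap E K)) = ⊤) :
    Function.Surjective (compositeMap F' E F K) := by
  rw [← AlgHom.range_eq_top, eq_top_iff, ← algebraAdjoin_eq_top (F' := F') h,
    Algebra.adjoin_le_iff]
  rintro _ ⟨x, rfl⟩
  exact ⟨1 ⊗ₜ x, by
    change compositeMap F' E F K (1 ⊗ₜ x) = _
    rw [compositeMap_tmul, map_one, one_mul]⟩

lemma finrank_le_of_adjoin [FiniteDimensional F' E]
    (h : IntermediateField.adjoin F (Set.range (algebraMap E K)) = ⊤) :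
    FiniteDimensional F K ∧ Module.finrank F K ≤ Module.finrank F' E := by
  have hφ := compositeMap_surjective (F' := F') h
  refine ⟨Module.Finite.of_surjective (compositeMap F' E F K).toLinearMap hφ, ?_⟩
  rw [← Module.finrank_baseChange (R := F) (S := F') (M' := E)]
  exact LinearMap.finrank_le_finrank_of_surjective
    (f := (compositeMap F' E F K).toLinearMap) hφ

end Composite

/-! ### Ramification indices -/

section Ramification

variable {F L : Type*} [Field F] [Field L] [Algebra F L] {v : Valuation F ℤᵐ⁰}
  {w : Valuation L ℤᵐ⁰} {e : ℕ}

lemma HasRamificationIndex.log_val (h : HasRamificationIndex v w e) (x : F) :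
    log (w (algebraMap F L x)) = e * log (v x) := by
  rw [h.2, log_pow, nsmul_eq_mul]

lemma HasRamificationIndex.val_of_val (h : HasRamificationIndex v w e) {x : F} {i : ℤ}
    (hx : v x = exp i) : w (algebraMap F L x) = exp (e * i) := by
  rw [h.2, hx, ← exp_nsmul, nsmul_eq_mul]

lemma HasRamificationIndex.val_le_of_val_le (h : HasRamificationIndex v w e) {x : F} {i : ℤ}
    (hx : v x ≤ exp i) : w (algebraMap F L x) ≤ exp (e * i) := by
  rw [h.2]
  calc v x ^ e ≤ exp i ^ e := pow_le_pow_left₀ zero_le hx e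
    _ = exp (e * i) := by rw [← exp_nsmul, nsmul_eq_mul]

lemma exists_hasRamificationIndex (v : Valuation F ℤᵐ⁰) (w : Valuation L ℤᵐ⁰) [v.HasExtension w]
    (hv : Function.Surjective v) : ∃ e, HasRamificationIndex v w e := by
  obtain ⟨ϖ, hϖ⟩ := exists_isUnif hv
  have h1 : w (algebraMap F L ϖ) < 1 := by
    rw [Valuation.HasExtension.val_map_lt_one_iff v w, hϖ, ← exp_zero, exp_lt_exp]
    norm_num
  have h2 := exp_log_of_val_ne w (x := algebraMap F L ϖ) (by simpa using hϖ.ne_zero)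
  set m := log (w (algebraMap F L ϖ))
  rw [h2, ← exp_zero, exp_lt_exp] at h1
  refine ⟨(-m).toNat, by omega, fun x => ?_⟩
  have hm : (((-m).toNat : ℕ) : ℤ) = -m := by omega
  rcases eq_or_ne x 0 with rfl | hx
  · rw [map_zero, map_zero, map_zero, zero_pow (by omega)]
  have h3 := exp_log_of_val_ne v hx
  set i := log (v x)
  -- A unit of `F` stays a unit in `L`, so the value of `x` is determined by that of `ϖ`.
  have h4 : v (x * ϖ ^ i) = 1 := by
    rw [map_mul, hϖ.val_zpow, h3, ← exp_add, add_neg_cancel, exp_zero]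
  rw [← Valuation.HasExtension.val_map_eq_one_iff v w, map_mul, map_mul, map_zpow₀, map_zpow₀, h2,
    ← exp_zsmul] at h4
  rw [eq_inv_of_mul_eq_one_left h4, ← exp_neg, h3, ← exp_nsmul, exp_inj, nsmul_eq_mul, hm,
    smul_eq_mul]
  ring

lemma HasRamificationIndex.valGroup_eq (h : HasRamificationIndex v w e)
    (hv : Function.Surjective v) : valGroup F w = AddSubgroup.zmultiples (e : ℤ) := by
  ext i
  rw [Int.mem_zmultiples_iff]
  constructor
  · rintro ⟨a, ha⟩
    have := h.log_val a
    rw [ha, log_exp] at this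
    exact ⟨_, this⟩
  · rintro ⟨c, rfl⟩
    obtain ⟨a, ha⟩ := hv (exp c)
    exact ⟨a, h.val_of_val ha⟩

lemma HasRamificationIndex.trans {M : Type*} [Field M] [Algebra L M] [Algebra F M]
    [IsScalarTower F L M] {u : Valuation M ℤᵐ⁰} {e' : ℕ} (h : HasRamificationIndex v w e)
    (h' : HasRamificationIndex w u e') : HasRamificationIndex v u (e * e') := by
  refine ⟨Nat.mul_pos h.1 h'.1, fun x => ?_⟩
  rw [IsScalarTower.algebraMap_apply F L M, h'.2, h.2, pow_mul]

/-- The valuation `w ∘ σ` extends `v` with the same index, so uniqueness applies. -/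
lemma val_map_eq_of_extends (hv : IsCompleteDVF v) [FiniteDimensional F L]
    (h : HasRamificationIndex v w e) (σ : L →+* L)
    (hσ : ∀ a, σ (algebraMap F L a) = algebraMap F L a) (x : L) : w (σ x) = w x := by
  have h' : HasRamificationIndex v (w.comap σ) e :=
    ⟨h.1, fun a => by rw [Valuation.comap_apply, hσ, h.2]⟩
  exact (pow_left_inj₀ zero_le zero_le h.1.ne').1 (val_pow_eq_of_extends hv h' h x)

end Ramification

/-! ### Composites with tame extensions -/

section Tame

variable {k₀' K' k₀ K : Type*} [Field k₀'] [Field K'] [Field k₀] [Field K]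
  [Algebra k₀' K'] [Algebra K' K] [Algebra k₀' K] [IsScalarTower k₀' K' K]
  [Algebra k₀' k₀] [Algebra k₀ K] [IsScalarTower k₀' k₀ K]

/-- Let `E` be the index of `K/K'`. Comparing the two routes from `k₀'` to `K` shows that `e ∣ N *
E`, so `E = e * E'` by coprimality. Then `K/k₀` has index `N * E'`, while its degree is at most `N`;
hence `E' = 1`. -/
theorem tame_composite [FiniteDimensional k₀' K'] [FiniteDimensional k₀' k₀]
    (hK : IntermediateField.adjoin k₀ (Set.range (algebraMap K' K)) = ⊤)
    {v₀' : Valuation k₀' ℤᵐ⁰} {v' : Valuation K' ℤᵐ⁰} {v₀ : Valuation k₀ ℤᵐ⁰}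
    {v : Valuation K ℤᵐ⁰} [v'.HasExtension v]
    (hv₀' : IsCompleteDVF v₀') (hv' : Function.Surjective v')
    (hv₀ : Function.Surjective v₀) (hv : Function.Surjective v) {e : ℕ}
    (hN : HasRamificationIndex v₀' v' (Module.finrank k₀' K'))
    (he : HasRamificationIndex v₀' v₀ e) (hcop : Nat.Coprime e (Module.finrank k₀' K')) :
    FiniteDimensional k₀ K ∧ Module.finrank k₀ K = Module.finrank k₀' K' ∧
      HasRamificationIndex v' v e ∧ HasRamificationIndex v₀ v (Module.finrank k₀' K') := by
  obtain ⟨hfin, hle⟩ := finrank_le_of_adjoin (F' := k₀') hK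
  set N := Module.finrank k₀' K' with hNdef
  obtain ⟨E, hE⟩ := exists_hasRamificationIndex v' v hv'
  have hNE := hN.trans hE
  -- It is not yet known how `v` restricts to `k₀`. The restriction is compared with `v₀` as a
  -- second, not necessarily normalised, extension of `v₀'`.
  have hw : HasRamificationIndex v₀' (v.comap (algebraMap k₀ K)) (N * E) :=
    ⟨hNE.1, fun x => by
      rw [Valuation.comap_apply, ← IsScalarTower.algebraMap_apply, hNE.2]⟩
  have huniq : ∀ x : k₀, v₀ x ^ (N * E) = v (algebraMap k₀ K x) ^ e := fun x =>
    val_pow_eq_of_extends hv₀' he hw x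
  have hlog : ∀ x : k₀, (N * E : ℤ) * log (v₀ x) = e * log (v (algebraMap k₀ K x)) := by
    intro x
    have := congrArg log (huniq x)
    rw [log_pow, log_pow, nsmul_eq_mul, nsmul_eq_mul] at this
    exact_mod_cast this
  obtain ⟨E', rfl⟩ : e ∣ E := by
    obtain ⟨x, hx⟩ := hv₀ (exp 1)
    have h1 := hlog x
    rw [hx, log_exp, mul_one] at h1
    have h2 : (e : ℤ) ∣ N * E := ⟨_, h1⟩
    exact hcop.dvd_of_dvd_mul_left (by exact_mod_cast h2)
  have he0 : (e : ℤ) ≠ 0 := by exact_mod_cast he.1.ne'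
  have hE' : 0 < E' := Nat.pos_of_mul_pos_left hE.1
  have hv₀v : HasRamificationIndex v₀ v (N * E') := by
    refine ⟨Nat.mul_pos hN.1 hE', fun x => ?_⟩
    rcases eq_or_ne x 0 with rfl | hx
    · rw [map_zero, map_zero, map_zero, zero_pow (Nat.mul_pos hN.1 hE').ne']
    rw [exp_log_of_val_ne v (x := algebraMap k₀ K x) (by simpa using hx),
      exp_log_of_val_ne v₀ hx, ← exp_nsmul, exp_inj, nsmul_eq_mul]
    have := hlog x
    apply mul_left_cancel₀ he0
    rw [← this]
    push_cast
    ring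
  have hidx := index_valGroup_le (M := k₀) hv
  rw [hv₀v.valGroup_eq hv₀, Int.index_zmultiples, Int.natAbs_natCast] at hidx
  have hE1 : E' = 1 := by
    have h3 : N * E' ≤ N * 1 := by omega
    have := Nat.le_of_mul_le_mul_left h3 hN.1
    omega
  subst hE1
  rw [mul_one] at *
  exact ⟨hfin, le_antisymm hle hidx, hE, hv₀v⟩

/-- The product map from `k₀ ⊗ K'` to `K` is surjective between spaces of equal dimension, hence
injective. -/
theorem linearDisjoint_of_finrank_eq [FiniteDimensional k₀' K'] [FiniteDimensional k₀ K]
    (hK : IntermediateField.adjoin k₀ (Set.range (algebraMap K' K)) = ⊤)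
    (h : Module.finrank k₀ K = Module.finrank k₀' K') :
    IntermediateField.LinearDisjoint (IsScalarTower.toAlgHom k₀' K' K).fieldRange k₀ := by
  let b := Module.finBasis k₀' K'
  refine IntermediateField.LinearDisjoint.of_basis_left
    (b.map (AlgEquiv.ofInjectiveField (IsScalarTower.toAlgHom k₀' K' K)).toLinearEquiv) ?_
  have hinj : Function.Injective (compositeMap k₀' K' k₀ K).toLinearMap := by
    rw [LinearMap.injective_iff_surjective_of_finrank_eq_finrank]
    · exact compositeMap_surjective hK
    · rw [Module.finrank_baseChange, h]
  have hli := (b.baseChange k₀).linearIndependent.map' _ (LinearMap.ker_eq_bot.2 hinj)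
  have heq : (compositeMap k₀' K' k₀ K).toLinearMap ∘ b.baseChange k₀ =
      fun i => algebraMap K' K (b i) := by
    ext i
    change compositeMap k₀' K' k₀ K (b.baseChange k₀ i) = _
    rw [Module.Basis.baseChange_apply, compositeMap_tmul, map_one, one_mul]
  rw [heq] at hli
  exact hli

end Tame

/-! ### Galois groups of composites. -/

section Galois

variable {k' K' k K : Type*} [Field k'] [Field K'] [Field k] [Field K]
  [Algebra k' K'] [Algebra k' k] [Algebra k K] [Algebra k' K] [Algebra K' K]
  [IsScalarTower k' k K] [IsScalarTower k' K' K]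

/-- A separable polynomial with splitting field `K'` over `k'` has splitting field `K` over `k`. -/
theorem isGalois_composite [FiniteDimensional k' K'] [IsGalois k' K']
    (hK : IntermediateField.adjoin k (Set.range (algebraMap K' K)) = ⊤) : IsGalois k K := by
  obtain ⟨p, hsep, hsplit⟩ := IsGalois.is_separable_splitting_field k' K'
  have h1 := hsplit.splits
  suffices Polynomial.IsSplittingField k K (p.map (algebraMap k' k)) from
    IsGalois.of_separable_splitting_field (p := p.map (algebraMap k' k)) hsep.map
  constructor
  · rw [Polynomial.map_map, ← IsScalarTower.algebraMap_eq, IsScalarTower.algebraMap_eq k' K' K,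
      ← Polynomial.map_map]
    exact h1.map _
  · rw [eq_top_iff, ← algebraAdjoin_eq_top (F' := k') hK, Algebra.adjoin_le_iff]
    rintro _ ⟨x, rfl⟩
    have hx : x ∈ Algebra.adjoin k' (p.rootSet K') := by
      rw [hsplit.adjoin_rootSet]; trivial
    induction hx using Algebra.adjoin_induction with
    | mem x hx =>
      apply Algebra.subset_adjoin
      rw [Polynomial.mem_rootSet] at hx ⊢
      refine ⟨Polynomial.map_ne_zero hx.1, ?_⟩
      rw [Polynomial.aeval_map_algebraMap, Polynomial.aeval_algebraMap_apply, hx.2, map_zero]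
    | algebraMap a =>
      rw [← IsScalarTower.algebraMap_apply, IsScalarTower.algebraMap_apply k' k K]
      exact Subalgebra.algebraMap_mem _ _
    | add x y _ _ hx hy => rw [map_add]; exact add_mem hx hy
    | mul x y _ _ hx hy => rw [map_mul]; exact mul_mem hx hy

lemma algebraMap_restrictGal [Normal k' K'] (τ : K ≃ₐ[k] K) (x : K') :
    algebraMap K' K (restrictGal k' K' τ x) = τ (algebraMap K' K x) :=
  AlgEquiv.restrictNormal_commutes _ _ _

theorem restrictGal_bijective [FiniteDimensional k' K'] [IsGalois k' K'] [FiniteDimensional k K]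
    [IsGalois k K] (hK : IntermediateField.adjoin k (Set.range (algebraMap K' K)) = ⊤)
    (h : Module.finrank k K = Module.finrank k' K') :
    Function.Bijective (restrictGal k' K' : (K ≃ₐ[k] K) → (K' ≃ₐ[k'] K')) := by
  rw [Nat.bijective_iff_injective_and_card, IsGalois.card_aut_eq_finrank,
    IsGalois.card_aut_eq_finrank]
  refine ⟨fun σ τ hστ => ?_, h⟩
  have h1 : ∀ x : K', σ (algebraMap K' K x) = τ (algebraMap K' K x) := by
    intro x
    rw [← algebraMap_restrictGal (k' := k'), hστ, algebraMap_restrictGal]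
  have h2 : Algebra.adjoin k (Set.range (algebraMap K' K)) ≤
      AlgHom.equalizer (σ : K →ₐ[k] K) (τ : K →ₐ[k] K) := by
    rw [Algebra.adjoin_le_iff]
    rintro _ ⟨x, rfl⟩
    exact h1 x
  rw [algebraAdjoin_eq_top (F' := k') hK] at h2
  ext x
  exact h2 (Algebra.mem_top : x ∈ _)

end Galois

/-! ### Totally ramified extensions -/

/-- `L/F` is totally ramified with respect to the normalised valuation `w` of `L`. -/
structure TotRam (F : Type*) {L : Type*} [Field F] [Field L] [Algebra F L]
    (w : Valuation L ℤᵐ⁰) : Prop where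
  surjective : Function.Surjective w
  valGroup_eq : valGroup F w = AddSubgroup.zmultiples (Module.finrank F L : ℤ)

section TotRam

variable {F L : Type*} [Field F] [Field L] [Algebra F L] {w : Valuation L ℤᵐ⁰}

namespace TotRam

lemma exists_val_eq (h : TotRam F w) (c : ℤ) :
    ∃ a : F, w (algebraMap F L a) = exp (Module.finrank F L * c) := by
  rw [← mem_valGroup, h.valGroup_eq, Int.mem_zmultiples_iff]
  exact dvd_mul_right _ _

lemma dvd_of_val_eq (h : TotRam F w) {a : F} {i : ℤ} (ha : w (algebraMap F L a) = exp i) :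
    (Module.finrank F L : ℤ) ∣ i := by
  rw [← Int.mem_zmultiples_iff, ← h.valGroup_eq]
  exact ⟨a, ha⟩

variable {θ : L} {e : ℤ}

/-- As `e` is invertible modulo the degree, the multiples `e * j` lie in different classes. This
isolates one index in all the sums below. -/
lemma eq_of_dvd (he : IsCoprime e (Module.finrank F L : ℤ)) {i j : Fin (Module.finrank F L)}
    (h : (Module.finrank F L : ℤ) ∣ e * (i - j : ℤ)) : i = j := by
  have h1 := he.symm.dvd_of_dvd_mul_left h
  have hi := i.2
  have hj := j.2
  have h2 := Int.eq_zero_of_abs_lt_dvd h1 (by rw [abs_lt]; omega)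
  ext
  omega

lemma linearIndependent_pow (h : TotRam F w) (hθ : w θ = exp (-e))
    (he : IsCoprime e (Module.finrank F L : ℤ)) :
    LinearIndependent F fun j : Fin (Module.finrank F L) => θ ^ (j : ℕ) := by
  refine linearIndependent_of_val (w := w) _ (fun j => (j : ℤ) * (-e)) (fun j => ?_)
    fun i j hij => eq_of_dvd he ?_
  · rw [Algebra.algebraMap_self, RingHom.id_apply, map_pow, hθ, ← exp_nsmul, nsmul_eq_mul]
  · rw [h.valGroup_eq, Int.mem_zmultiples_iff] at hij
    have h1 : (i : ℤ) * -e - (j : ℤ) * -e = -(e * (i - j : ℤ)) := by ring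
    rwa [h1, dvd_neg] at hij

/-- The basis consisting of powers of an element whose value is coprime to the degree. -/
noncomputable def powBasis [FiniteDimensional F L] (h : TotRam F w) (hθ : w θ = exp (-e))
    (he : IsCoprime e (Module.finrank F L : ℤ)) :
    Module.Basis (Fin (Module.finrank F L)) F L :=
  have : Nonempty (Fin (Module.finrank F L)) := ⟨⟨0, Module.finrank_pos⟩⟩
  basisOfLinearIndependentOfCardEqFinrank (h.linearIndependent_pow hθ he) (by simp)

lemma powBasis_apply [FiniteDimensional F L] (h : TotRam F w) (hθ : w θ = exp (-e))
    (he : IsCoprime e (Module.finrank F L : ℤ)) (j : Fin (Module.finrank F L)) :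
    h.powBasis hθ he j = θ ^ (j : ℕ) := by
  simp [powBasis]

/-- Elements of `L` are approximated by elements of `F`. -/
lemma exists_approx [FiniteDimensional F L] (h : TotRam F w) {x : L} {c : ℤ}
    (hx : w x ≤ exp (Module.finrank F L * c)) :
    ∃ a : F, w (algebraMap F L a) ≤ exp (Module.finrank F L * c) ∧
      w (x - algebraMap F L a) ≤ exp (Module.finrank F L * c - 1) := by
  obtain ⟨ϖ, hϖ⟩ := h.surjective (exp (-1))
  have hco : IsCoprime (1 : ℤ) (Module.finrank F L : ℤ) := isCoprime_one_left
  let b := h.powBasis hϖ hco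
  have hsum := b.sum_repr x
  have hterm : ∀ j, b.repr x j ≠ 0 → w (b.repr x j • b j)
      = exp (log (w (algebraMap F L (b.repr x j))) - j) := by
    intro j hj
    rw [Algebra.smul_def, map_mul, h.powBasis_apply, map_pow, hϖ, ← exp_nsmul,
      exp_log_of_val_ne w (x := algebraMap F L (b.repr x j)) (by simpa using hj), ← exp_add,
      log_exp]
    congr 1
    simp [sub_eq_add_neg]
  have hdvd : ∀ j, b.repr x j ≠ 0 →
      (Module.finrank F L : ℤ) ∣ log (w (algebraMap F L (b.repr x j))) := fun j hj =>
    h.dvd_of_val_eq (exp_log_of_val_ne w (by simpa using hj))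
  have hle := val_le_val_sum w Finset.univ (fun j => b.repr x j • b j) (by
    intro i _ j _ hij h0 heq
    have hi : b.repr x i ≠ 0 := fun h1 => h0 (by simp [h1])
    have hj : b.repr x j ≠ 0 := by
      intro h1
      rw [h1, zero_smul, map_zero, Valuation.zero_iff] at heq
      exact h0 heq
    rw [hterm i hi, hterm j hj, exp_inj] at heq
    refine hij (eq_of_dvd hco ?_)
    have h5 : (1 : ℤ) * ((i : ℕ) - (j : ℕ) : ℤ) = log (w (algebraMap F L (b.repr x i)))
        - log (w (algebraMap F L (b.repr x j))) := by linarith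
    rw [h5]
    exact (hdvd i hi).sub (hdvd j hj))
  rw [hsum] at hle
  -- The values of the terms are distinct modulo the degree, so only the constant term can have a
  -- value divisible by it. That term is the approximation.
  let j0 : Fin (Module.finrank F L) := ⟨0, Module.finrank_pos⟩
  have hb0 : b j0 = 1 := by rw [h.powBasis_apply]; simp [j0]
  refine ⟨b.repr x j0, ?_, ?_⟩
  · have := hle j0 (Finset.mem_univ _)
    rw [Algebra.smul_def, hb0, mul_one] at this
    exact this.trans hx
  · have hx' : x - algebraMap F L (b.repr x j0)
        = ∑ j ∈ Finset.univ.erase j0, b.repr x j • b j := by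
      rw [← Finset.add_sum_erase _ _ (Finset.mem_univ j0), Algebra.smul_def, hb0, mul_one] at hsum
      rw [sub_eq_iff_eq_add', hsum]
    rw [hx']
    refine w.map_sum_le fun j hj => ?_
    rw [Finset.mem_erase] at hj
    rcases eq_or_ne (b.repr x j) 0 with h0 | h0
    · simp [h0]
    have h1 := (hle j (Finset.mem_univ _)).trans hx
    rw [hterm j h0, exp_le_exp] at h1 ⊢
    by_contra hlt
    have h2 : (Module.finrank F L : ℤ) ∣ (1 : ℤ) * (j - j0 : ℤ) := by
      have h3 : log (w (algebraMap F L (b.repr x j))) - j = Module.finrank F L * c := by omega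
      have h4 : (1 : ℤ) * ((j : ℕ) - (j0 : ℕ) : ℤ)
          = log (w (algebraMap F L (b.repr x j))) - Module.finrank F L * c := by
        simp only [j0]; push_cast; linarith
      rw [h4]
      exact (hdvd j h0).sub (dvd_mul_right _ _)
    exact hj.1 (eq_of_dvd hco h2)

end TotRam

/-! ### Automorphisms and traces -/

variable (F) in
/-- The trace, with values in the large field. -/
noncomputable abbrev tr (x : L) : L := algebraMap F L (Algebra.trace F L x)

lemma tr_mul (a : F) (x : L) : tr F (algebraMap F L a * x) = algebraMap F L a * tr F x := by
  rw [tr, ← Algebra.smul_def, map_smul, smul_eq_mul, map_mul]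

section Galois

variable {θ : L} {e : ℤ}

lemma TotRam.aut_injective [FiniteDimensional F L] (h : TotRam F w) (hθ : w θ = exp (-e))
    (he : IsCoprime e (Module.finrank F L : ℤ)) :
    Function.Injective fun σ : L ≃ₐ[F] L => σ θ := by
  intro σ τ hστ
  have : (σ : L →ₗ[F] L) = τ := (h.powBasis hθ he).ext fun j => by
    rw [h.powBasis_apply]
    change σ (θ ^ (j : ℕ)) = τ (θ ^ (j : ℕ))
    rw [map_pow, map_pow]
    exact congrArg (· ^ (j : ℕ)) hστ
  ext x
  exact LinearMap.congr_fun this x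

variable [FiniteDimensional F L] [IsGalois F L]

/-- The conjugates `σ θ` are distinct and as many as the degree, so their Vandermonde matrix is
invertible. Surjectivity of the same map gives coordinates for every element of `K[G]`. -/
lemma TotRam.eq_zero_of_sum_aut (h : TotRam F w) (hθ : w θ = exp (-e))
    (he : IsCoprime e (Module.finrank F L : ℤ)) {z : Fin (Module.finrank F L) → L}
    (hz : ∀ σ : L ≃ₐ[F] L, ∑ j, z j * σ θ ^ (j : ℕ) = 0) : z = 0 := by
  have hc : Nat.card (L ≃ₐ[F] L) = Module.finrank F L := IsGalois.card_aut_eq_finrank F L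
  let E : Fin (Module.finrank F L) ≃ (L ≃ₐ[F] L) := (finCongr hc.symm).trans
    (Finite.equivFin (L ≃ₐ[F] L)).symm
  exact Matrix.eq_zero_of_forall_index_sum_mul_pow_eq_zero
    (f := fun j => E j θ) ((h.aut_injective hθ he).comp E.injective) fun j => hz (E j)

lemma TotRam.exists_coords (h : TotRam F w) (hθ : w θ = exp (-e))
    (he : IsCoprime e (Module.finrank F L : ℤ)) (f : (L ≃ₐ[F] L) → L) :
    ∃ z : Fin (Module.finrank F L) → L, ∀ σ, f σ = ∑ j, z j * σ θ ^ (j : ℕ) := by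
  let Φ : (Fin (Module.finrank F L) → L) →ₗ[L] ((L ≃ₐ[F] L) → L) :=
    LinearMap.pi fun σ => ∑ j : Fin (Module.finrank F L), (σ θ ^ (j : ℕ)) • LinearMap.proj j
  have hΦ : ∀ z σ, Φ z σ = ∑ j, z j * σ θ ^ (j : ℕ) := by
    intro z σ
    simp [Φ, mul_comm]
  have hinj : Function.Injective Φ := by
    rw [← LinearMap.ker_eq_bot, LinearMap.ker_eq_bot']
    intro z hz
    exact h.eq_zero_of_sum_aut hθ he fun σ => by rw [← hΦ, hz]; rfl
  have hsurj := (LinearMap.injective_iff_surjective_of_finrank_eq_finrank (f := Φ) (by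
    rw [Module.finrank_fintype_fun_eq_card, Module.finrank_fintype_fun_eq_card, Fintype.card_fin,
      ← Nat.card_eq_fintype_card, IsGalois.card_aut_eq_finrank])).1 hinj
  obtain ⟨z, hz⟩ := hsurj f
  exact ⟨z, fun σ => by rw [← hΦ, hz]⟩

lemma val_tr_le (hσ : ∀ (σ : L ≃ₐ[F] L) x, w (σ x) = w x) (x : L) : w (tr F x) ≤ w x := by
  rw [tr, trace_eq_sum_automorphisms]
  exact w.map_sum_le fun σ _ => (hσ σ x).le

variable (F w) in
-- The supremum defining `differentVal` is meaningful because the set is nonempty (integral elements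
-- have integral trace) and bounded (the trace is surjective, so some element has a nonintegral
-- trace). In `ℤ` it is then attained.
lemma differentVal_spec (h : TotRam F w) (hσ : ∀ (σ : L ≃ₐ[F] L) x, w (σ x) = w x) :
    (∀ x : L, w x ≤ exp (differentVal F w) → w (tr F x) ≤ 1) ∧
      ∃ x : L, w x ≤ exp (differentVal F w + 1) ∧ 1 < w (tr F x) := by
  set S := {m : ℤ | ∀ x : L, w x ≤ exp m → w (tr F x) ≤ 1} with hS
  have hne : S.Nonempty := ⟨0, fun x hx => (val_tr_le hσ x).trans (by simpa using hx)⟩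
  have hn : (0 : ℤ) < Module.finrank F L := by exact_mod_cast Module.finrank_pos
  obtain ⟨a, ha⟩ := h.exists_val_eq 1
  obtain ⟨x, hx⟩ := Algebra.trace_surjective F L a
  have hbdd : BddAbove S := by
    refine ⟨log (w x), fun m hm => ?_⟩
    by_contra hlt
    have := hm x (le_exp_of_log_le (by omega))
    rw [tr, hx, ha, ← exp_zero, exp_le_exp] at this
    omega
  have hD : differentVal F w = sSup S := rfl
  refine ⟨hD ▸ Int.csSup_mem hne hbdd, ?_⟩
  by_contra hcon
  push Not at hcon
  have := le_csSup hbdd (show differentVal F w + 1 ∈ S from hcon)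
  rw [← hD] at this
  omega

/-- Scaling by an element of `F` moves `x` into the inverse different. The summand `-n + 1` in
`depth` is the slack lost when rounding down to a multiple of `n`. -/
lemma TotRam.val_tr_le_floor (h : TotRam F w) (hσ : ∀ (σ : L ≃ₐ[F] L) x, w (σ x) = w x) {x : L}
    {i : ℤ} (hx : w x ≤ exp i) :
    w (tr F x) ≤ exp (Module.finrank F L * ((i - depth F w) / Module.finrank F L)) := by
  have hn : (0 : ℤ) < Module.finrank F L := by exact_mod_cast Module.finrank_pos
  set q := (i - depth F w) / (Module.finrank F L : ℤ) with hq
  obtain ⟨a, ha⟩ := h.exists_val_eq (-q)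
  have hlt : i - depth F w < Module.finrank F L * (q + 1) := by
    have := Int.lt_ediv_add_one_mul_self (i - depth F w) hn
    rw [mul_comm]
    exact this
  have h1 := (differentVal_spec F w h hσ).1 (algebraMap F L a * x) (by
    rw [map_mul, ha]
    calc exp (Module.finrank F L * -q) * w x ≤ exp (Module.finrank F L * -q) * exp i := by gcongr
      _ ≤ _ := by
        rw [← exp_add, exp_le_exp]
        rw [depth] at hlt
        linarith)
  rw [tr_mul, map_mul, ha] at h1
  calc w (tr F x) = exp (Module.finrank F L * q) * (exp (Module.finrank F L * -q) * w (tr F x)) := by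
        rw [← mul_assoc, ← exp_add, mul_neg, add_neg_cancel, exp_zero, one_mul]
    _ ≤ exp (Module.finrank F L * q) * 1 := by gcongr
    _ = _ := mul_one _

lemma TotRam.val_tr_le (h : TotRam F w) (hσ : ∀ (σ : L ≃ₐ[F] L) x, w (σ x) = w x) {x : L}
    {i : ℤ} (hx : w x ≤ exp i) : w (tr F x) ≤ exp (i - depth F w) := by
  refine (h.val_tr_le_floor hσ hx).trans ?_
  rw [exp_le_exp]
  exact Int.mul_ediv_self_le (by exact_mod_cast Module.finrank_pos.ne')

lemma TotRam.val_tr_le_of_not_dvd (h : TotRam F w)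
    (hσ : ∀ (σ : L ≃ₐ[F] L) x, w (σ x) = w x) {x : L}
    {i : ℤ} (hx : w x ≤ exp i) (hi : ¬ (Module.finrank F L : ℤ) ∣ i - depth F w) :
    w (tr F x) ≤ exp (i - depth F w - 1) := by
  refine (h.val_tr_le_floor hσ hx).trans ?_
  rw [exp_le_exp, Int.le_sub_one_iff]
  refine lt_of_le_of_ne (Int.mul_ediv_self_le (by exact_mod_cast Module.finrank_pos.ne')) ?_
  intro h1
  exact hi ⟨_, h1.symm⟩

/-- Maximality of the inverse different provides an element just outside it with nonintegral trace.
A rescaled copy `z` is at most as large as `x` and has a trace of the maximal size. Up to a smaller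
error `z` is an integral element of `F` times `x`, and the trace of the error is too small, so `tr
x` must be maximal as well. -/
lemma TotRam.val_tr_eq (h : TotRam F w) (hσ : ∀ (σ : L ≃ₐ[F] L) x, w (σ x) = w x) {x : L}
    {i : ℤ} (hx : w x = exp i) (hi : (Module.finrank F L : ℤ) ∣ i - depth F w) :
    w (tr F x) = exp (i - depth F w) := by
  set n := (Module.finrank F L : ℤ) with hnd
  have hn : (0 : ℤ) < n := by
    exact Int.natCast_pos.2 (Module.finrank_pos : 0 < Module.finrank F L)
  set d := depth F w with hd
  have hdD : d = differentVal F w - n + 1 := rfl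
  obtain ⟨y, hy, hty⟩ := (differentVal_spec F w h hσ).2
  obtain ⟨c, hc⟩ := hi
  -- scale `y` so that its trace has the maximal value allowed by its size
  obtain ⟨a, ha⟩ := h.exists_val_eq (c - 1)
  have hy' : w (algebraMap F L a * y) ≤ exp i := by
    rw [map_mul, ha]
    calc _ ≤ exp (n * (c - 1)) * exp (differentVal F w + 1) := by gcongr
      _ ≤ _ := by rw [← exp_add, exp_le_exp]; linarith
  have hty' : exp (i - d - 1) < w (tr F (algebraMap F L a * y)) := by
    have h0 : tr F y ≠ 0 := by
      intro h0
      rw [h0, map_zero] at hty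
      exact not_lt_zero hty
    have h1 := exp_log_of_val_ne w h0
    obtain ⟨m, hm⟩ := h.dvd_of_val_eq h1
    rw [h1, ← exp_zero, exp_lt_exp, hm] at hty
    have hm0 : 0 < m := by nlinarith
    rw [tr_mul, map_mul, ha, h1, ← exp_add, exp_lt_exp, hm, hc]
    have : n ≤ n * m := le_mul_of_one_le_right hn.le hm0
    linarith
  set z := algebraMap F L a * y
  have hx0 : x ≠ 0 := by
    rintro rfl
    rw [map_zero] at hx
    exact exp_ne_zero hx.symm
  obtain ⟨b, hb, hzb⟩ := h.exists_approx (x := z / x) (c := 0) (by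
    rw [mul_zero, map_div₀, hx]
    exact div_le_of_le_mul₀ zero_le zero_le (by rwa [exp_zero, one_mul]))
  rw [mul_zero] at hb hzb
  have hrest : w (tr F ((z / x - algebraMap F L b) * x)) ≤ exp (i - d - 1) := by
    have := h.val_tr_le hσ (x := (z / x - algebraMap F L b) * x) (i := i - 1) (by
      rw [map_mul, hx]
      calc _ ≤ exp (0 - 1) * exp i := by gcongr
        _ ≤ _ := by rw [← exp_add, exp_le_exp]; linarith)
    convert this using 2
    omega
  have hsplit : tr F z = algebraMap F L b * tr F x + tr F ((z / x - algebraMap F L b) * x) := by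
    rw [← tr_mul, tr, tr, tr, ← map_add, ← map_add]
    congr 2
    field_simp
    ring
  refine le_antisymm (h.val_tr_le hσ hx.le) ?_
  by_contra hlt
  push Not at hlt
  rw [lt_exp_iff] at hlt
  refine hty'.not_ge ?_
  rw [hsplit]
  refine w.map_add_le ?_ hrest
  rw [map_mul]
  calc _ ≤ exp 0 * exp (i - d - 1) := by gcongr
    _ = _ := by rw [exp_zero, one_mul]

/-- Up to higher order terms the trace is linear over the elements with values in the value group
of the base field. -/
lemma TotRam.val_tr_mul_sub_le (h : TotRam F w) (hσ : ∀ (σ : L ≃ₐ[F] L) x, w (σ x) = w x)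
    {x y : L} {i c : ℤ} (hx : w x ≤ exp i) (hy : w y = exp (Module.finrank F L * c)) :
    w (tr F (y * x) - y * tr F x) ≤ exp (Module.finrank F L * c + i - depth F w - 1) := by
  -- For `a ∈ F` in place of `y` the difference vanishes, so only the smaller error `y - a`
  -- contributes.
  obtain ⟨a, ha, hya⟩ := h.exists_approx hy.le
  have : tr F (y * x) - y * tr F x =
      tr F ((y - algebraMap F L a) * x) - (y - algebraMap F L a) * tr F x := by
    have h1 : y * x = (y - algebraMap F L a) * x + algebraMap F L a * x := by ring
    have h2 : tr F (y * x) = tr F ((y - algebraMap F L a) * x) + algebraMap F L a * tr F x := by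
      rw [← tr_mul, tr, tr, tr, ← map_add, ← map_add, ← h1]
    rw [h2]
    ring
  rw [this]
  refine w.map_sub_le ?_ ?_
  · have := h.val_tr_le hσ (x := (y - algebraMap F L a) * x)
      (i := Module.finrank F L * c - 1 + i) (by
        rw [map_mul, exp_add]
        gcongr)
    convert this using 2
    ring
  · rw [map_mul]
    calc _ ≤ exp (Module.finrank F L * c - 1) * exp (i - depth F w) := by
          gcongr
          exact h.val_tr_le hσ hx
      _ = _ := by
          rw [← exp_add]
          congr 1
          ring

end Galois

end TotRam

/-! ### Reduction to the residue field -/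

section Reduction

variable {L : Type*} [Field L] {w : Valuation L ℤᵐ⁰} {x y : L}

lemma red_eq (hx : w x ≤ 1) : red w x = IsLocalRing.residue w.valuationSubring ⟨x, hx⟩ :=
  dif_pos hx

lemma red_mul (hx : w x ≤ 1) (hy : w y ≤ 1) : red w (x * y) = red w x * red w y := by
  have hxy : w (x * y) ≤ 1 := by rw [map_mul]; exact mul_le_one' hx hy
  rw [red_eq hx, red_eq hy, red_eq hxy, ← map_mul]
  rfl

lemma red_add (hx : w x ≤ 1) (hy : w y ≤ 1) : red w (x + y) = red w x + red w y := by
  rw [red_eq hx, red_eq hy, red_eq (w.map_add_le hx hy), ← map_add]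
  rfl

lemma red_zero : red w 0 = 0 := by
  rw [red_eq (by simp : w 0 ≤ 1)]
  exact map_zero _

lemma red_sum {ι : Type*} (s : Finset ι) (f : ι → L) (hf : ∀ i ∈ s, w (f i) ≤ 1) :
    red w (∑ i ∈ s, f i) = ∑ i ∈ s, red w (f i) := by
  classical
  induction s using Finset.induction_on with
  | empty => simp [red_zero]
  | insert a s ha ih =>
    rw [Finset.forall_mem_insert] at hf
    rw [Finset.sum_insert ha, Finset.sum_insert ha, red_add hf.1 (w.map_sum_le hf.2), ih hf.2]

lemma red_eq_zero_iff (hx : w x ≤ 1) : red w x = 0 ↔ w x < 1 := by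
  rw [red_eq hx, IsLocalRing.residue_eq_zero_iff, Valuation.mem_maximalIdeal_iff]

lemma red_eq_red (hy : w y ≤ 1) (h : w (x - y) < 1) : red w x = red w y := by
  have : x = y + (x - y) := by ring
  rw [this, red_add hy h.le, (red_eq_zero_iff h.le).2 h, add_zero]

end Reduction

/-! ### Levels and leading terms -/

section LinearIndependence

lemma linearIndependent_root_pow (κ : Type*) [Field κ] {n : ℕ} (hn : n ≠ 0) :
    LinearIndependent κ
      fun j : Fin n => (AdjoinRoot.root (Polynomial.X ^ n - 1 : κ[X])) ^ (j : ℕ) := by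
  have hmon : (Polynomial.X ^ n - 1 : κ[X]).Monic := by
    simpa using Polynomial.monic_X_pow_sub_C (1 : κ) hn
  have hdeg : (Polynomial.X ^ n - 1 : κ[X]).natDegree = n := by
    simpa using Polynomial.natDegree_X_pow_sub_C (n := n) (r := (1 : κ))
  have h1 := (AdjoinRoot.powerBasis' hmon).basis.linearIndependent
  have h2 := h1.comp (finCongr (by rw [AdjoinRoot.powerBasis'_dim, hdeg])) (Equiv.injective _)
  have heq : (fun j : Fin n => (AdjoinRoot.root (Polynomial.X ^ n - 1 : κ[X])) ^ (j : ℕ)) =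
      (AdjoinRoot.powerBasis' hmon).basis ∘ finCongr (by rw [AdjoinRoot.powerBasis'_dim, hdeg]) := by
    ext j
    simp
  rw [heq]
  exact h2

lemma linearIndependent_sum_smul_iff {κ A ι : Type*} [Field κ] [AddCommGroup A] [Module κ A]
    {n : ℕ} {r : Fin n → A} (hr : LinearIndependent κ r) (c : ι → Fin n → κ) :
    LinearIndependent κ (fun i => ∑ j, c i j • r j) ↔ LinearIndependent κ c := by
  have hΛ : LinearMap.ker (Fintype.linearCombination κ r) = ⊥ := by
    rw [LinearMap.ker_eq_bot]
    exact linearIndependent_iff_injective_fintypeLinearCombination.1 hr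
  rw [← LinearMap.linearIndependent_iff _ hΛ]
  rfl

end LinearIndependence

section Level

variable {F L : Type*} [Field F] [Field L] [Algebra F L] {w : Valuation L ℤᵐ⁰}

/-- `f` is the image of `∑ z_j ⊗ θ ^ j` under the isomorphism `K ⊗ K → K[G]`. -/
def IsCoords (θ : L) (f : GrpAlg F L) (z : Fin (Module.finrank F L) → L) : Prop :=
  ∀ σ, f.coeff σ = ∑ j, z j * σ θ ^ (j : ℕ)

/-- The minimal value of the terms `z_j θ ^ j` is `s`. -/
def HasOrder (w : Valuation L ℤᵐ⁰) (θ : L) {n : ℕ} (z : Fin n → L) (s : ℤ) : Prop :=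
  (∀ j, w (z j * θ ^ (j : ℕ)) ≤ exp (-s)) ∧ ∃ j, w (z j * θ ^ (j : ℕ)) = exp (-s)

lemma exists_hasOrder {θ : L} (hθ : θ ≠ 0) {n : ℕ} {z : Fin n → L} (hz : z ≠ 0) :
    ∃ s, HasOrder w θ z s := by
  obtain ⟨i, hi⟩ := Function.ne_iff.1 hz
  obtain ⟨j, -, hj⟩ := Finset.univ.exists_max_image (fun j => w (z j * θ ^ (j : ℕ)))
    ⟨i, Finset.mem_univ i⟩
  have h0 : z j * θ ^ (j : ℕ) ≠ 0 := by
    intro h0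
    have := hj i (Finset.mem_univ i)
    rw [h0, map_zero, le_zero_iff, Valuation.zero_iff] at this
    exact mul_ne_zero hi (pow_ne_zero _ hθ) this
  refine ⟨-log (w (z j * θ ^ (j : ℕ))), ?_, j, ?_⟩
  · intro i
    rw [neg_neg, exp_log (w.ne_zero_iff.2 h0)]
    exact hj i (Finset.mem_univ i)
  · rw [neg_neg, exp_log (w.ne_zero_iff.2 h0)]

lemma val_coord_le {θ : L} {e : ℤ} (hθ : w θ = exp (-e)) {x : L} {s : ℤ} {j : ℕ}
    (h : w (x * θ ^ j) ≤ exp (-s)) : w x ≤ exp (e * j - s) := by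
  have h1 : w θ ^ j = exp (-(e * j)) := by
    rw [hθ, ← exp_nsmul, nsmul_eq_mul]
    congr 1
    ring
  rw [map_mul, map_pow, h1] at h
  calc w x = w x * exp (-(e * j)) * exp (e * j) := by
        rw [mul_assoc, ← exp_add, neg_add_cancel, exp_zero, mul_one]
    _ ≤ exp (-s) * exp (e * j) := by gcongr
    _ = _ := by rw [← exp_add]; congr 1; ring

lemma val_coord_eq {θ : L} {e : ℤ} (hθ : w θ = exp (-e)) {x : L} {s : ℤ} {j : ℕ}
    (h : w (x * θ ^ j) = exp (-s)) : w x = exp (e * j - s) := by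
  have h1 : w θ ^ j = exp (-(e * j)) := by
    rw [hθ, ← exp_nsmul, nsmul_eq_mul]
    congr 1
    ring
  rw [map_mul, map_pow, h1] at h
  calc w x = w x * exp (-(e * j)) * exp (e * j) := by
        rw [mul_assoc, ← exp_add, neg_add_cancel, exp_zero, mul_one]
    _ = _ := by rw [h, ← exp_add]; congr 1; ring

variable [FiniteDimensional F L] [IsGalois F L]

/-- Exchanging the sums over `j` and `σ` turns the action into a combination of traces, to which the
trace estimates apply. -/
lemma act_eq_sum {θ : L} {f : GrpAlg F L} {z : Fin (Module.finrank F L) → L}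
    (hz : IsCoords θ f z) (x : L) : act f x = ∑ j, z j * tr F (θ ^ (j : ℕ) * x) := by
  rw [act, Finsupp.sum_fintype _ _ (fun _ => by simp)]
  simp_rw [tr, trace_eq_sum_automorphisms, Finset.mul_sum, hz _, Finset.sum_mul]
  rw [Finset.sum_comm]
  refine Finset.sum_congr rfl fun j _ => Finset.sum_congr rfl fun σ _ => ?_
  rw [map_mul, map_pow, mul_assoc]

variable {θ : L} {e : ℤ}

lemma val_act_term_le (h : TotRam F w) (hσ : ∀ (σ : L ≃ₐ[F] L) x, w (σ x) = w x)
    (hθ : w θ = exp (-e)) {z y : L} {s m : ℤ} {j : ℕ} (hz : w (z * θ ^ j) ≤ exp (-s))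
    (hy : w y ≤ exp m) : w (z * tr F (θ ^ j * y)) ≤ exp (m - s - depth F w) := by
  have h1 : w (θ ^ j * y) ≤ exp (m - e * j) := by
    rw [map_mul, map_pow, hθ, ← exp_nsmul, sub_eq_neg_add, exp_add, nsmul_eq_mul]
    have : (j : ℤ) * -e = -(e * j) := by ring
    rw [this]
    gcongr
  rw [map_mul]
  calc _ ≤ exp (e * j - s) * exp (m - e * j - depth F w) := by
        gcongr
        · exact val_coord_le hθ hz
        · exact h.val_tr_le hσ h1
    _ = _ := by rw [← exp_add]; congr 1; ring

lemma val_act_term_le_of_not_dvd (h : TotRam F w) (hσ : ∀ (σ : L ≃ₐ[F] L) x, w (σ x) = w x)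
    (hθ : w θ = exp (-e)) {z y : L} {s m : ℤ} {j : ℕ} (hz : w (z * θ ^ j) ≤ exp (-s))
    (hy : w y = exp m) (hm : ¬ (Module.finrank F L : ℤ) ∣ m - e * j - depth F w) :
    w (z * tr F (θ ^ j * y)) ≤ exp (m - s - depth F w - 1) := by
  have h1 : w (θ ^ j * y) = exp (m - e * j) := by
    rw [map_mul, map_pow, hθ, ← exp_nsmul, sub_eq_neg_add, exp_add, nsmul_eq_mul, hy]
    have : (j : ℤ) * -e = -(e * j) := by ring
    rw [this]
  rw [map_mul]
  calc _ ≤ exp (e * j - s) * exp (m - e * j - depth F w - 1) := by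
        gcongr
        · exact val_coord_le hθ hz
        · exact h.val_tr_le_of_not_dvd hσ h1.le hm
    _ = _ := by rw [← exp_add]; congr 1; ring

lemma val_act_term_eq (h : TotRam F w) (hσ : ∀ (σ : L ≃ₐ[F] L) x, w (σ x) = w x)
    (hθ : w θ = exp (-e)) {z y : L} {s m : ℤ} {j : ℕ} (hz : w (z * θ ^ j) = exp (-s))
    (hy : w y = exp m) (hm : (Module.finrank F L : ℤ) ∣ m - e * j - depth F w) :
    w (z * tr F (θ ^ j * y)) = exp (m - s - depth F w) := by
  have h1 : w (θ ^ j * y) = exp (m - e * j) := by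
    rw [map_mul, map_pow, hθ, ← exp_nsmul, sub_eq_neg_add, exp_add, nsmul_eq_mul, hy]
    have : (j : ℤ) * -e = -(e * j) := by ring
    rw [this]
  rw [map_mul, val_coord_eq hθ hz, h.val_tr_eq hσ h1 hm, ← exp_add]
  congr 1
  ring

lemma level_eq (h : TotRam F w) (hσ : ∀ (σ : L ≃ₐ[F] L) x, w (σ x) = w x)
    (hθ : w θ = exp (-e)) (he : IsCoprime e (Module.finrank F L : ℤ)) {f : GrpAlg F L}
    {z : Fin (Module.finrank F L) → L} (hz : IsCoords θ f z) {s : ℤ} (hs : HasOrder w θ z s) :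
    level w f = s + depth F w := by
  refine IsGreatest.csSup_eq ⟨?_, ?_⟩
  · intro x hx
    rw [act_eq_sum hz]
    refine w.map_sum_le fun j _ => ?_
    have hx' := exp_log_of_val_ne w hx
    refine (val_act_term_le h hσ hθ (hs.1 j) hx'.le).trans_eq ?_
    conv_rhs => rw [hx', ← exp_add]
    congr 1
    ring
  · intro i hi
    by_contra hlt
    obtain ⟨j, hj⟩ := hs.2
    -- For this value of `x` the divisibility needed for a sharp trace estimate holds at the index
    -- `j` and at no other, so the `j`-th term dominates.
    obtain ⟨x, hx⟩ := h.surjective (exp (depth F w + e * j))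
    have hx0 : x ≠ 0 := by
      rintro rfl
      rw [map_zero] at hx
      exact exp_ne_zero hx.symm
    have h1 := val_act_term_eq h hσ hθ hj hx (by simp)
    have h2 : w (act f x) = w (z j * tr F (θ ^ (j : ℕ) * x)) := by
      classical
      rw [act_eq_sum hz, w.map_sum_eq_of_lt (Finset.mem_univ j)]
      intro i hi
      rw [Finset.mem_sdiff, Finset.mem_singleton] at hi
      rw [h1]
      refine (val_act_term_le_of_not_dvd h hσ hθ (hs.1 i) hx ?_).trans_lt ?_
      · intro hd
        refine hi.2 (TotRam.eq_of_dvd he ?_).symm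
        have h3 : depth F w + e * (j : ℕ) - e * (i : ℕ) - depth F w
            = e * ((j : ℕ) - (i : ℕ) : ℤ) := by ring
        rwa [h3] at hd
      · rw [exp_lt_exp]; omega
    have h3 := hi x hx0
    rw [h2, h1, hx, ← exp_add, exp_le_exp] at h3
    omega

lemma dFun_eq (h : TotRam F w) (hσ : ∀ (σ : L ≃ₐ[F] L) x, w (σ x) = w x)
    (hθ : w θ = exp (-e)) (he : IsCoprime e (Module.finrank F L : ℤ)) {f : GrpAlg F L}
    {z : Fin (Module.finrank F L) → L} (hz : IsCoords θ f z) {s : ℤ} (hs : HasOrder w θ z s) :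
    dFun w f = s := by
  rw [dFun, level_eq h hσ hθ he hz hs, add_sub_cancel_right]

variable (F L) in
/-- The exponent `l` with `l ≡ s - e j` modulo the degree. -/
noncomputable def expIndex (e s : ℤ) (j : Fin (Module.finrank F L)) : Fin (Module.finrank F L) :=
  ⟨((s - e * j) % Module.finrank F L).toNat, by
    have hn : (0 : ℤ) < Module.finrank F L := by exact_mod_cast Module.finrank_pos
    have h1 := Int.emod_lt_of_pos (s - e * j) hn
    have h2 := Int.emod_nonneg (s - e * j) hn.ne'
    omega⟩

omit [IsGalois F L] in
lemma dvd_expIndex (s : ℤ) (j : Fin (Module.finrank F L)) :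
    (Module.finrank F L : ℤ) ∣ s - e * j - (expIndex F L e s j : ℕ) := by
  have hn : (0 : ℤ) < Module.finrank F L := by exact_mod_cast Module.finrank_pos
  have h2 := Int.emod_nonneg (s - e * j) hn.ne'
  rw [expIndex]
  simp only
  rw [Int.toNat_of_nonneg h2]
  exact Int.dvd_self_sub_emod

omit [IsGalois F L] in
lemma expIndex_injective (he : IsCoprime e (Module.finrank F L : ℤ)) (s : ℤ) :
    Function.Injective (expIndex F L e s) := by
  intro i j hij
  refine TotRam.eq_of_dvd he ?_
  have := (dvd_expIndex (e := e) s j).sub (dvd_expIndex (e := e) s i)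
  rw [hij] at this
  have h2 : e * ((i : ℕ) - (j : ℕ) : ℤ) = s - e * j - (expIndex F L e s j : ℕ)
      - (s - e * i - (expIndex F L e s j : ℕ)) := by ring
  rwa [h2]

omit [IsGalois F L] in
lemma expIndex_congr {s s' : ℤ} (h : s ≡ s' [ZMOD Module.finrank F L]) :
    expIndex F L e s = expIndex F L e s' := by
  ext j
  simp only [expIndex]
  rw [show (s - e * j) % (Module.finrank F L : ℤ) = (s' - e * j) % (Module.finrank F L : ℤ) from
    h.sub_right _]

lemma val_traceUnit (h : TotRam F w) (hσ : ∀ (σ : L ≃ₐ[F] L) x, w (σ x) = w x) {ϖ : L}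
    (hϖ : IsUnif w ϖ) : w (traceUnit F w ϖ) = 1 := by
  have := h.val_tr_eq hσ (hϖ.val_zpow (-depth F w)) (by simp)
  rw [traceUnit, this]
  simp

/-- The coefficients of `𝔭(f)`. -/
lemma red_act (h : TotRam F w) (hσ : ∀ (σ : L ≃ₐ[F] L) x, w (σ x) = w x) {ϖ : L}
    (hϖ : IsUnif w ϖ) (hθ : w θ = exp (-e)) (he : IsCoprime e (Module.finrank F L : ℤ))
    {f : GrpAlg F L} {z : Fin (Module.finrank F L) → L} (hz : IsCoords θ f z) {s : ℤ}
    (hs : HasOrder w θ z s) (j : Fin (Module.finrank F L)) :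
    red w (act f (ϖ ^ (((expIndex F L e s j : ℕ) : ℤ) - (s + depth F w))) /
        ϖ ^ (expIndex F L e s j : ℕ)) =
      red w (traceUnit F w ϖ) * red w (z j * θ ^ (j : ℕ) / ϖ ^ s) := by
  obtain ⟨c, hc⟩ := dvd_expIndex (e := e) s j
  set l : ℤ := ((expIndex F L e s j : ℕ) : ℤ) with hl
  set d := depth F w with hd
  have hϖ0 := hϖ.ne_zero
  have hu := val_traceUnit h hσ hϖ
  have hzj : w (z j * θ ^ (j : ℕ) / ϖ ^ s) ≤ 1 := by
    rw [map_div₀, hϖ.val_zpow]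
    exact div_le_of_le_mul₀ zero_le zero_le (by rw [one_mul]; exact hs.1 j)
  rw [← red_mul hu.le hzj]
  refine red_eq_red (by rw [map_mul, hu, one_mul]; exact hzj) ?_
  rw [← zpow_natCast ϖ (expIndex F L e s j : ℕ), ← hl]
  -- At the index `j` the factor `θ ^ j * ϖ ^ (l - s)` has a value divisible by the degree and can
  -- be pulled out of the trace up to higher order, leaving `tr (ϖ ^ (-d))`. At all other indices
  -- divisibility fails and the trace gains one more in value.
  have hsplit : act f (ϖ ^ (l - (s + d))) / ϖ ^ l - traceUnit F w ϖ * (z j * θ ^ (j : ℕ) / ϖ ^ s)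
      = (z j * (tr F ((θ ^ (j : ℕ) * ϖ ^ (l - s)) * ϖ ^ (-d))
          - (θ ^ (j : ℕ) * ϖ ^ (l - s)) * tr F (ϖ ^ (-d)))
        + ∑ i ∈ Finset.univ.erase j, z i * tr F (θ ^ (i : ℕ) * ϖ ^ (l - (s + d)))) / ϖ ^ l := by
    rw [act_eq_sum hz, ← Finset.add_sum_erase _ _ (Finset.mem_univ j)]
    have h1 : θ ^ (j : ℕ) * ϖ ^ (l - (s + d)) = θ ^ (j : ℕ) * ϖ ^ (l - s) * ϖ ^ (-d) := by
      rw [mul_assoc, ← zpow_add₀ hϖ0]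
      congr 2
      ring
    have h2 : ϖ ^ (l - s) = ϖ ^ l / ϖ ^ s := zpow_sub₀ hϖ0 _ _
    have h3 : ϖ ^ l ≠ 0 := zpow_ne_zero _ hϖ0
    have h4 : ϖ ^ s ≠ 0 := zpow_ne_zero _ hϖ0
    have h5 : traceUnit F w ϖ = tr F (ϖ ^ (-d)) := rfl
    rw [h1, h5]
    generalize tr F (θ ^ (j : ℕ) * ϖ ^ (l - s) * ϖ ^ (-d)) = A
    generalize tr F (ϖ ^ (-d)) = B
    generalize (∑ i ∈ Finset.univ.erase j, z i * tr F (θ ^ (i : ℕ) * ϖ ^ (l - (s + d)))) = C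
    rw [h2]
    field_simp
    ring
  rw [hsplit, map_div₀, hϖ.val_zpow]
  rw [div_lt_iff₀ exp_pos, one_mul, lt_exp_iff]
  refine w.map_add_le ?_ (w.map_sum_le fun i hi => ?_)
  · have hy : w (θ ^ (j : ℕ) * ϖ ^ (l - s)) = exp (Module.finrank F L * c) := by
      rw [map_mul, map_pow, hθ, hϖ.val_zpow, ← exp_nsmul, ← exp_add, nsmul_eq_mul, ← hc]
      congr 1
      ring
    rw [map_mul]
    calc _ ≤ exp (e * j - s) * exp (Module.finrank F L * c + - -d - d - 1) := by
          gcongr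
          · exact val_coord_le hθ (hs.1 j)
          · exact h.val_tr_mul_sub_le hσ (hϖ.val_zpow _).le hy
      _ = _ := by
          rw [← hc, ← exp_add]
          congr 1
          ring
  · rw [Finset.mem_erase] at hi
    refine (val_act_term_le_of_not_dvd h hσ hθ (hs.1 i) (hϖ.val_zpow _) ?_).trans_eq ?_
    · intro hdv
      refine hi.1 (TotRam.eq_of_dvd he ?_)
      have h3 : e * ((i : ℕ) - (j : ℕ) : ℤ) = (s - e * (j : ℕ) - l)
          - (-(l - (s + d)) - e * (i : ℕ) - depth F w) := by rw [← hd]; ring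
      rw [h3, hc]
      exact (dvd_mul_right _ _).sub hdv
    · congr 1
      rw [← hd]
      ring

lemma gp_eq_sum (h : TotRam F w) (hσ : ∀ (σ : L ≃ₐ[F] L) x, w (σ x) = w x) {ϖ : L}
    (hϖ : IsUnif w ϖ) (hθ : w θ = exp (-e)) (he : IsCoprime e (Module.finrank F L : ℤ))
    {f : GrpAlg F L} {z : Fin (Module.finrank F L) → L} (hz : IsCoords θ f z) {s : ℤ}
    (hs : HasOrder w θ z s) :
    gp w ϖ f = ∑ j, red w (z j * θ ^ (j : ℕ) / ϖ ^ s) •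
      (AdjoinRoot.root _ : QuotRing F w) ^ (expIndex F L e s j : ℕ) := by
  have hu := val_traceUnit h hσ hϖ
  have hu' : red w (traceUnit F w ϖ) ≠ 0 := by
    rw [Ne, red_eq_zero_iff hu.le, hu]
    exact lt_irrefl _
  have hbij : Function.Bijective (expIndex F L e s) :=
    Finite.injective_iff_bijective.1 (expIndex_injective he s)
  rw [gp, gradedPiece, level_eq h hσ hθ he hz hs, Finset.sum_range,
    ← hbij.sum_comp, Finset.smul_sum]
  refine Finset.sum_congr rfl fun j _ => ?_
  rw [red_act h hσ hϖ hθ he hz hs j, smul_smul, inv_mul_cancel_left₀ hu']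

omit [IsGalois F L] in
lemma linearIndependent_root_pow_expIndex (he : IsCoprime e (Module.finrank F L : ℤ)) (s : ℤ) :
    LinearIndependent (Res w)
      fun j => (AdjoinRoot.root _ : QuotRing F w) ^ (expIndex F L e s j : ℕ) :=
  (linearIndependent_root_pow (Res w) (Module.finrank_pos.ne' : Module.finrank F L ≠ 0)).comp _
    (expIndex_injective (F := F) (L := L) he s)

omit [IsGalois F L] in
lemma linearIndependent_expIndex_iff (he : IsCoprime e (Module.finrank F L : ℤ)) (s : ℤ)
    {ι : Type*} (c : ι → Fin (Module.finrank F L) → Res w) :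
    LinearIndependent (Res w) (fun i => ∑ j, c i j •
      (AdjoinRoot.root _ : QuotRing F w) ^ (expIndex F L e s j : ℕ)) ↔
        LinearIndependent (Res w) c :=
  linearIndependent_sum_smul_iff (linearIndependent_root_pow_expIndex he s) c

/-- Linear independence of leading terms in terms of coordinates. -/
theorem linearIndependent_gp_iff (h : TotRam F w) (hσ : ∀ (σ : L ≃ₐ[F] L) x, w (σ x) = w x)
    {ϖ : L} (hϖ : IsUnif w ϖ) (hθ : w θ = exp (-e)) (he : IsCoprime e (Module.finrank F L : ℤ))
    {ι : Type*} {f : ι → GrpAlg F L} {z : ι → Fin (Module.finrank F L) → L}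
    (hz : ∀ i, IsCoords θ (f i) (z i)) {s : ι → ℤ} (hs : ∀ i, HasOrder w θ (z i) (s i))
    {s₀ : ℤ} (hcong : ∀ i, s i ≡ s₀ [ZMOD Module.finrank F L]) :
    LinearIndependent (Res w) (fun i => gp w ϖ (f i)) ↔
      LinearIndependent (Res w)
        (fun i j => red w (z i j * θ ^ (j : ℕ) / ϖ ^ s i) : ι → Fin (Module.finrank F L) → Res w) := by
  -- Orders congruent modulo the degree give the same exponents, so all leading terms are expanded
  -- in one common independent family.
  have heq : (fun i => gp w ϖ (f i)) = fun i => ∑ j, red w (z i j * θ ^ (j : ℕ) / ϖ ^ s i) •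
      (AdjoinRoot.root _ : QuotRing F w) ^ (expIndex F L e s₀ j : ℕ) := by
    ext1 i
    rw [gp_eq_sum h hσ hϖ hθ he (hz i) (hs i), expIndex_congr (hcong i)]
  rw [heq]
  exact linearIndependent_expIndex_iff he s₀ _

end Level

/-! ### Diagonal elements -/

/-- Modulo `a` the product becomes `∏ (-c i)`, so `a` divides a unit. -/
lemma isUnit_of_prod_sub_eq_zero {A ι : Type*} [CommRing A] (t : Finset ι) (a : A) (c : ι → A)
    (hc : ∀ i ∈ t, IsUnit (c i)) (h : ∏ i ∈ t, (a - c i) = 0) : IsUnit a := by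
  have h1 : a ∣ ∏ i ∈ t, (-c i) := by
    rw [← Ideal.mem_span_singleton, ← Ideal.Quotient.eq_zero_iff_mem]
    have h2 := congrArg (Ideal.Quotient.mk (Ideal.span {a})) h
    have h3 : Ideal.Quotient.mk (Ideal.span {a}) a = 0 :=
      Ideal.Quotient.eq_zero_iff_mem.2 (Ideal.mem_span_singleton_self a)
    simpa [map_prod, h3] using h2
  refine isUnit_of_dvd_unit h1 ?_
  rw [IsUnit.prod_iff]
  exact fun i hi => (hc i hi).neg

section Diagonal

variable {F L : Type*} [Field F] [Field L] [Algebra F L] {w : Valuation L ℤᵐ⁰}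

lemma phiCoeff_tmul (σ : L ≃ₐ[F] L) (x y : L) : phiCoeff σ (x ⊗ₜ[F] y) = x * σ y := by
  simp [phiCoeff]

lemma tmul_mem_intTensor {x y : L} (hx : w x ≤ 1) (hy : w y ≤ 1) :
    x ⊗ₜ[F] y ∈ intTensor F w :=
  Subring.subset_closure ⟨x, y, hx, hy, rfl⟩

lemma phiCoeff_injective [FiniteDimensional F L] [IsGalois F L] (h : TotRam F w) {α : L ⊗[F] L}
    (hα : ∀ σ : L ≃ₐ[F] L, phiCoeff σ α = 0) : α = 0 := by
  obtain ⟨ϖ, hϖ⟩ := h.surjective (exp (-1))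
  have hco : IsCoprime (1 : ℤ) (Module.finrank F L : ℤ) := isCoprime_one_left
  let b := (h.powBasis hϖ hco).baseChange L
  have hb : ∀ j, b j = 1 ⊗ₜ (ϖ ^ (j : ℕ)) := by
    intro j
    rw [Module.Basis.baseChange_apply, h.powBasis_apply]
  have hsum : α = ∑ j, (b.repr α j) ⊗ₜ[F] (ϖ ^ (j : ℕ)) := by
    conv_lhs => rw [← b.sum_repr α]
    refine Finset.sum_congr rfl fun j _ => ?_
    rw [hb, TensorProduct.smul_tmul', smul_eq_mul, mul_one]
  have h0 : (fun j => b.repr α j) = 0 := h.eq_zero_of_sum_aut hϖ hco fun σ => by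
    rw [← hα σ]
    conv_rhs => rw [hsum]
    rw [map_sum]
    refine Finset.sum_congr rfl fun j _ => ?_
    rw [phiCoeff_tmul, map_pow]
  rw [hsum]
  refine Finset.sum_eq_zero fun j _ => ?_
  rw [congrFun h0 j, Pi.zero_apply, TensorProduct.zero_tmul]

/-- By injectivity of `φ`, `α` is a root of `∏ (X - φ_σ(α) ⊗ 1)`: the component at `τ` kills the
factor at `τ`. The constants `φ_σ(α) ⊗ 1` are units of `𝔒 ⊗ 𝔒`, hence so is `α`. -/
lemma exists_inv_mem_intTensor [FiniteDimensional F L] [IsGalois F L] (h : TotRam F w)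
    {α : L ⊗[F] L} (hα : α ∈ intTensor F w) (h1 : ∀ σ : L ≃ₐ[F] L, w (phiCoeff σ α) = 1) :
    ∃ η ∈ intTensor F w, α * η = 1 := by
  let c : (L ≃ₐ[F] L) → intTensor F w := fun σ =>
    ⟨phiCoeff σ α ⊗ₜ 1, tmul_mem_intTensor (h1 σ).le (by simp)⟩
  have hunit : IsUnit (⟨α, hα⟩ : intTensor F w) := by
    refine isUnit_of_prod_sub_eq_zero Finset.univ _ c (fun σ _ => ?_) ?_
    · have h2 : phiCoeff σ α ≠ 0 := by
        intro h0
        have := h1 σ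
        rw [h0, map_zero] at this
        exact zero_ne_one this
      refine IsUnit.of_mul_eq_one ⟨(phiCoeff σ α)⁻¹ ⊗ₜ 1, tmul_mem_intTensor (by
        rw [map_inv₀, h1, inv_one]) (by simp)⟩ ?_
      ext
      change (phiCoeff σ α ⊗ₜ[F] (1 : L)) * ((phiCoeff σ α)⁻¹ ⊗ₜ[F] (1 : L)) = 1
      rw [Algebra.TensorProduct.tmul_mul_tmul, mul_inv_cancel₀ h2, mul_one]
      rfl
    · ext
      push_cast
      refine phiCoeff_injective h fun τ => ?_
      rw [map_prod]
      refine Finset.prod_eq_zero (Finset.mem_univ τ) ?_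
      rw [map_sub, phiCoeff_tmul, map_one, mul_one, sub_self]
  obtain ⟨η, hη⟩ := hunit.exists_right_inv
  exact ⟨η, η.2, congrArg Subtype.val hη⟩

/-- A pure tensor of total value at least `n - 1` is integral. -/
lemma tmul_mem_intTensor_of_add [FiniteDimensional F L] (h : TotRam F w) {x y : L} {a b : ℤ}
    (hx : w x ≤ exp (-a)) (hy : w y ≤ exp (-b)) (hab : (Module.finrank F L : ℤ) - 1 ≤ a + b) :
    x ⊗ₜ[F] y ∈ intTensor F w := by
  have hn : (0 : ℤ) < Module.finrank F L := by exact_mod_cast Module.finrank_pos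
  -- Moving `g ∈ F` across the tensor sign reduces the first exponent to the remainder of `a`, which
  -- is at most `n - 1`; the second exponent is then nonnegative.
  obtain ⟨g, hg⟩ := h.exists_val_eq (a / Module.finrank F L)
  have hdiv := Int.emod_add_mul_ediv a (Module.finrank F L)
  have h1 := Int.emod_nonneg a hn.ne'
  have h2 := Int.emod_lt_of_pos a hn
  have hg0 : g ≠ 0 := by
    rintro rfl
    rw [map_zero, map_zero] at hg
    exact exp_ne_zero hg.symm
  have heq : x ⊗ₜ[F] y = (g • x) ⊗ₜ[F] (g⁻¹ • y) := by
    rw [TensorProduct.smul_tmul, smul_smul, mul_inv_cancel₀ hg0, one_smul]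
  rw [heq]
  refine tmul_mem_intTensor ?_ ?_
  · rw [Algebra.smul_def, map_mul, hg]
    calc _ ≤ exp (Module.finrank F L * (a / Module.finrank F L)) * exp (-a) := by gcongr
      _ ≤ 1 := by
        rw [← exp_add, ← exp_zero, exp_le_exp]
        linarith
  · rw [Algebra.smul_def, map_mul, map_inv₀, map_inv₀, hg, ← exp_neg]
    calc _ ≤ exp (-(Module.finrank F L * (a / Module.finrank F L))) * exp (-b) := by gcongr
      _ ≤ 1 := by
        rw [← exp_add, ← exp_zero, exp_le_exp]
        linarith

/-- Divided by `ϖ ^ (s - e j₀) ⊗ ϖ ^ (e j₀)`, the nonminimal terms have total value at least `n -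
1`. They are therefore integral and can be added to the coefficient of one minimal index `j₀`, which
remains a unit. What is left is supported on pairs `(s - e j, e j)` of constant sum `s`. -/
theorem isDiagonal_of_gap [FiniteDimensional F L] [IsGalois F L] (h : TotRam F w)
    (hσ : ∀ (σ : L ≃ₐ[F] L) x, w (σ x) = w x) {ϖ θ : L} {e : ℤ} (hϖ : IsUnif w ϖ)
    (hθ : w θ = exp (-e)) (he : IsCoprime e (Module.finrank F L : ℤ)) {f : GrpAlg F L}
    {z : Fin (Module.finrank F L) → L} (hz : IsCoords θ f z) {s : ℤ} (hs : HasOrder w θ z s)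
    (hgap : ∀ j, w (z j * θ ^ (j : ℕ)) ≠ exp (-s) →
      w (z j * θ ^ (j : ℕ)) ≤ exp (-(s + (Module.finrank F L - 1)))) :
    IsDiagonal w ϖ f := by
  classical
  obtain ⟨j₀, hj₀⟩ := hs.2
  have hϖ0 := hϖ.ne_zero
  have hθj : ∀ j : ℕ, w (θ ^ j) = exp (-(e * j)) := by
    intro j
    rw [map_pow, hθ, ← exp_nsmul, nsmul_eq_mul]
    congr 1
    ring
  let J : Finset (Fin (Module.finrank F L)) :=
    Finset.univ.filter fun j => w (z j * θ ^ (j : ℕ)) = exp (-s)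
  have hJ : ∀ j, j ∈ J ↔ w (z j * θ ^ (j : ℕ)) = exp (-s) := by simp [J]
  let g : Fin (Module.finrank F L) → ℤ × ℤ := fun j => (s - e * j, e * j)
  have hg : Function.Injective g := by
    intro i j hij
    have h1 : e * (i : ℕ) = e * (j : ℕ) := congrArg Prod.snd hij
    refine TotRam.eq_of_dvd he ?_
    rw [mul_sub, h1, sub_self]
    exact dvd_zero _
  let R : L ⊗[F] L := ∑ i ∈ Jᶜ, (z i * ϖ ^ (-(s - e * j₀))) ⊗ₜ[F] (θ ^ (i : ℕ) * ϖ ^ (-(e * j₀)))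
  let ε₀ : Fin (Module.finrank F L) → L ⊗[F] L := fun j =>
    (z j * ϖ ^ (-(s - e * j))) ⊗ₜ[F] (θ ^ (j : ℕ) * ϖ ^ (-(e * j)))
  let ε : Fin (Module.finrank F L) → L ⊗[F] L := fun j => ε₀ j + if j = j₀ then R else 0
  -- sizes of the factors
  have hx : ∀ i ∈ Jᶜ, w (z i * ϖ ^ (-(s - e * j₀)))
      ≤ exp (-(e * j₀ - e * i + (Module.finrank F L - 1))) := by
    intro i hi
    rw [Finset.mem_compl, hJ] at hi
    have h1 := val_coord_le hθ (hgap i hi)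
    rw [map_mul, hϖ.val_zpow]
    calc _ ≤ exp (e * i - (s + (Module.finrank F L - 1))) * exp (- -(s - e * j₀)) := by gcongr
      _ = _ := by rw [← exp_add]; congr 1; ring
  have hy : ∀ i : Fin (Module.finrank F L), w (θ ^ (i : ℕ) * ϖ ^ (-(e * j₀)))
      = exp (-(e * i - e * j₀)) := by
    intro i
    rw [map_mul, hϖ.val_zpow, hθj, ← exp_add]
    congr 1
    ring
  have hx₀ : ∀ j ∈ J, w (z j * ϖ ^ (-(s - e * j))) = 1 := by
    intro j hj
    rw [hJ] at hj
    rw [map_mul, hϖ.val_zpow, val_coord_eq hθ hj, ← exp_add, ← exp_zero]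
    congr 1
    ring
  have hy₀ : ∀ j : Fin (Module.finrank F L), w (θ ^ (j : ℕ) * ϖ ^ (-(e * j))) = 1 := by
    intro j
    rw [map_mul, hϖ.val_zpow, hθj, ← exp_add, ← exp_zero]
    congr 1
    ring
  have hR : R ∈ intTensor F w := by
    refine sum_mem fun i hi => tmul_mem_intTensor_of_add h (hx i hi) (hy i).le ?_
    linarith
  have hRσ : ∀ σ : L ≃ₐ[F] L, w (phiCoeff σ R) < 1 := by
    intro σ
    rw [map_sum]
    refine w.map_sum_lt one_ne_zero fun i hi => ?_
    have hi0 : i ≠ j₀ := by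
      rintro rfl
      rw [Finset.mem_compl, hJ] at hi
      exact hi hj₀
    -- The gap `n - 1` gives a value strictly below `1` only if `n ≥ 2`, which holds since two
    -- different indices exist.
    have hn : 1 < Module.finrank F L := by
      have h1 := i.2
      have h2 := j₀.2
      have h3 : (i : ℕ) ≠ j₀ := fun h => hi0 (Fin.ext h)
      omega
    rw [phiCoeff_tmul, map_mul, hσ, hy]
    calc _ ≤ exp (-(e * j₀ - e * i + (Module.finrank F L - 1))) * exp (-(e * i - e * j₀)) := by
          gcongr
          exact hx i hi
      _ < 1 := by
          rw [← exp_add, ← exp_zero, exp_lt_exp]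
          have : (1 : ℤ) < Module.finrank F L := by exact_mod_cast hn
          linarith
  have hε : ∀ j ∈ J, ε j ∈ intTensor F w ∧ ∃ η ∈ intTensor F w, ε j * η = 1 := by
    intro j hj
    have hmem : ε j ∈ intTensor F w := by
      refine add_mem (tmul_mem_intTensor (hx₀ j hj).le (hy₀ j).le) ?_
      split_ifs
      · exact hR
      · exact zero_mem _
    refine ⟨hmem, exists_inv_mem_intTensor h hmem fun σ => ?_⟩
    have h1 : w (phiCoeff σ (ε₀ j)) = 1 := by
      rw [phiCoeff_tmul, map_mul, hσ, hx₀ j hj, hy₀, one_mul]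
    have h2 : w (phiCoeff σ (if j = j₀ then R else 0)) < 1 := by
      split_ifs
      · exact hRσ σ
      · simp
    change w (phiCoeff σ (ε₀ j + if j = j₀ then R else 0)) = 1
    rw [map_add, w.map_add_eq_of_lt_left (by rwa [h1]), h1]
  have hmul : ∀ (x y : L) (a b : ℤ), ((x * ϖ ^ (-a)) ⊗ₜ[F] (y * ϖ ^ (-b))) *
      ((ϖ ^ a) ⊗ₜ[F] (ϖ ^ b)) = x ⊗ₜ[F] y := by
    intro x y a b
    rw [Algebra.TensorProduct.tmul_mul_tmul, mul_assoc, mul_assoc, ← zpow_add₀ hϖ0,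
      ← zpow_add₀ hϖ0]
    simp
  refine ⟨∑ j, z j ⊗ₜ[F] (θ ^ (j : ℕ)), fun σ => ?_, J.image g, ⟨?_, Function.extend g ε 0, ?_, ?_⟩,
    s, ?_⟩
  · rw [hz σ, map_sum]
    refine Finset.sum_congr rfl fun j _ => ?_
    rw [phiCoeff_tmul, map_pow]
  · rintro a ha b hb hab ⟨c, h1, h2⟩
    obtain ⟨i, -, rfl⟩ := Finset.mem_image.1 ha
    obtain ⟨j, -, rfl⟩ := Finset.mem_image.1 hb
    -- Both pairs have sum `s`, so comparability forces equality of classes, and `n` divides `e * (i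
    -- - j)`.
    refine hab (congrArg g (TotRam.eq_of_dvd he ⟨-c, ?_⟩))
    simp only [g] at h1 h2
    linarith
  · intro a ha
    obtain ⟨j, hj, rfl⟩ := Finset.mem_image.1 ha
    rw [hg.extend_apply]
    exact hε j hj
  · rw [Finset.sum_image hg.injOn]
    have h1 : ∑ j ∈ J, ε j * ((ϖ ^ (g j).1) ⊗ₜ[F] (ϖ ^ (g j).2))
        = ∑ j ∈ J, z j ⊗ₜ[F] (θ ^ (j : ℕ)) + ∑ i ∈ Jᶜ, z i ⊗ₜ[F] (θ ^ (i : ℕ)) := by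
      simp only [ε, add_mul, Finset.sum_add_distrib]
      congr 1
      · exact Finset.sum_congr rfl fun j _ => hmul _ _ _ _
      · simp only [ite_mul, zero_mul]
        rw [Finset.sum_ite_eq' J j₀, if_pos ((hJ j₀).2 hj₀), Finset.sum_mul]
        exact Finset.sum_congr rfl fun j _ => hmul _ _ _ _
    simp only [hg.extend_apply]
    rw [h1, Finset.sum_add_sum_compl]
  · intro a ha
    obtain ⟨j, -, rfl⟩ := Finset.mem_image.1 ha
    simp [g]

end Diagonal

/-! ### Base change of graded independent sets -/

/-- Independence over `κ'` yields functionals dual to the `c' i`. Their matrix entries, mapped to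
`κ`, extract `g k * u k` from a relation. -/
lemma linearIndependent_of_baseChange {κ' κ ι : Type*} [Field κ'] [Field κ] [Algebra κ' κ]
    {n m : ℕ} {c' : ι → Fin n → κ'} (hc' : LinearIndependent κ' c') (c : ι → Fin m → κ)
    (u : ι → κ) (hu : ∀ i, u i ≠ 0) (E : Fin n ≃ Fin m)
    (h : ∀ i j, c i (E j) = u i * algebraMap κ' κ (c' i j)) : LinearIndependent κ c := by
  classical
  obtain ⟨ℓ, hℓ⟩ := LinearMap.exists_leftInverse_of_injective
    (Finsupp.linearCombination κ' c') (LinearMap.ker_eq_bot.2 hc')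
  have hℓ' : ∀ i k, ℓ (c' i) k = if i = k then 1 else 0 := by
    intro i k
    have := LinearMap.congr_fun hℓ (Finsupp.single i 1)
    rw [LinearMap.comp_apply, Finsupp.linearCombination_single, one_smul] at this
    rw [this, LinearMap.id_apply, Finsupp.single_apply]
  have hsum : ∀ i k, ∑ j, algebraMap κ' κ (c' i j) * algebraMap κ' κ (ℓ (Pi.single j 1) k)
      = if i = k then 1 else 0 := by
    intro i k
    have h1 : c' i = ∑ j, c' i j • (Pi.single j (1 : κ') : Fin n → κ') := by
      ext l
      simp [Finset.sum_apply, Pi.single_apply]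
    have h2 := hℓ' i k
    conv_lhs at h2 => rw [h1]
    rw [map_sum, Finsupp.finsetSum_apply] at h2
    simp only [map_smul, Finsupp.smul_apply, smul_eq_mul] at h2
    rw [← map_one (algebraMap κ' κ), ← map_zero (algebraMap κ' κ), ← apply_ite, ← h2, map_sum]
    simp only [map_mul]
  rw [linearIndependent_iff']
  intro t g hg k hk
  have h3 : ∑ j, (∑ i ∈ t, g i • c i) (E j) * algebraMap κ' κ (ℓ (Pi.single j 1) k) = g k * u k := by
    simp only [Finset.sum_apply, Pi.smul_apply, smul_eq_mul, h, Finset.sum_mul]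
    rw [Finset.sum_comm]
    have h4 : ∀ i ∈ t, ∑ j, g i * (u i * algebraMap κ' κ (c' i j)) *
        algebraMap κ' κ (ℓ (Pi.single j 1) k) = if i = k then g i * u i else 0 := by
      intro i _
      rw [← mul_one (g i * u i), ← mul_zero (g i * u i), ← mul_ite, ← hsum i k, Finset.mul_sum]
      refine Finset.sum_congr rfl fun j _ => ?_
      ring
    rw [Finset.sum_congr rfl h4, Finset.sum_ite_eq' t k, if_pos hk]
  rw [hg] at h3
  simp only [Pi.zero_apply, zero_mul, Finset.sum_const_zero] at h3
  exact (mul_eq_zero.1 h3.symm).resolve_right (hu k)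

lemma red_algebraMap {K' K : Type*} [Field K'] [Field K] [Algebra K' K] (v' : Valuation K' ℤᵐ⁰)
    (v : Valuation K ℤᵐ⁰) [v'.HasExtension v] {x : K'} (hx : v' x ≤ 1) :
    red v (algebraMap K' K x) = algebraMap (Res v') (Res v) (red v' x) := by
  have hx' : v (algebraMap K' K x) ≤ 1 := (Valuation.HasExtension.val_map_le_one_iff v' v x).2 hx
  rw [red_eq hx, red_eq hx']
  rfl

section BaseChange

variable {k₀' k' K' k₀ k K : Type*} [Field k₀'] [Field k'] [Field K'] [Field k₀] [Field k] [Field K]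
  [Algebra k' K'] [Algebra k' k] [Algebra k K] [Algebra k' K] [Algebra K' K]
  [IsScalarTower k' k K] [IsScalarTower k' K' K] [Algebra k₀' K'] [Algebra k₀ K]

/-- The properties of the composite of a totally ramified extension of `p`-power degree with a
tame extension that the lifting theorem depends on. -/
structure IsTameLift (k₀' k' k₀ k : Type*) {K' K : Type*} [Field k₀'] [Field k'] [Field K']
    [Field k₀] [Field k] [Field K] [Algebra k' K'] [Algebra k' k] [Algebra k K] [Algebra k' K]
    [Algebra K' K] [IsScalarTower k' k K] [IsScalarTower k' K' K] [Algebra k₀' K'] [Algebra k₀ K]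
    [Normal k' K'] (v' : Valuation K' ℤᵐ⁰) (v : Valuation K ℤᵐ⁰) (e : ℕ) : Prop where
  totRam' : TotRam k' v'
  totRam : TotRam k v
  baseTotRam' : TotRam k₀' v'
  baseTotRam : TotRam k₀ v
  val_aut' : ∀ (σ : K' ≃ₐ[k'] K') x, v' (σ x) = v' x
  val_aut : ∀ (σ : K ≃ₐ[k] K) x, v (σ x) = v x
  ramificationIndex : HasRamificationIndex v' v e
  coprime : IsCoprime (e : ℤ) (Module.finrank k₀' K' : ℤ)
  finrank_eq : Module.finrank k K = Module.finrank k' K'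
  baseFinrank_eq : Module.finrank k₀ K = Module.finrank k₀' K'
  finrank_dvd : Module.finrank k' K' ∣ Module.finrank k₀' K'
  bijective : Function.Bijective (restrictGal k' K' : (K ≃ₐ[k] K) → (K' ≃ₐ[k'] K'))

variable {v' : Valuation K' ℤᵐ⁰} {v : Valuation K ℤᵐ⁰} {e : ℕ}
  [IsGalois k' K']

namespace IsTameLift

lemma coprime_finrank (D : IsTameLift k₀' k' k₀ k v' v e) :
    IsCoprime (e : ℤ) (Module.finrank k K : ℤ) := by
  refine D.coprime.of_isCoprime_of_dvd_right ?_
  rw [D.finrank_eq]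
  exact Int.natCast_dvd_natCast.2 D.finrank_dvd

lemma val_unif (D : IsTameLift k₀' k' k₀ k v' v e) {ϖ' : K'} (hϖ' : IsUnif v' ϖ') :
    v (algebraMap K' K ϖ') = exp (-(e : ℤ)) := by
  rw [D.ramificationIndex.val_of_val hϖ', mul_neg, mul_one]

/-- The coordinates of the base change of an element. -/
noncomputable def liftCoords (D : IsTameLift k₀' k' k₀ k v' v e) (z : Fin (Module.finrank k' K') → K')
    (j : Fin (Module.finrank k K)) : K :=
  algebraMap K' K (z (Fin.cast D.finrank_eq j))

lemma isCoords_lift (D : IsTameLift k₀' k' k₀ k v' v e) {ϖ' : K'} {b : GrpAlg k' K'}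
    {z : Fin (Module.finrank k' K') → K'} (hz : IsCoords ϖ' b z) {f : GrpAlg k K}
    (hf : ∀ τ : K ≃ₐ[k] K, f.coeff τ = algebraMap K' K (b.coeff (restrictGal k' K' τ))) :
    IsCoords (algebraMap K' K ϖ') f (D.liftCoords z) := by
  intro τ
  rw [hf, hz, map_sum, ← (finCongr D.finrank_eq).sum_comp]
  refine Finset.sum_congr rfl fun j _ => ?_
  rw [map_mul, map_pow, algebraMap_restrictGal]
  rfl

lemma val_liftCoords_mul (D : IsTameLift k₀' k' k₀ k v' v e) {ϖ' : K'}
    (z : Fin (Module.finrank k' K') → K') (j : Fin (Module.finrank k K)) :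
    D.liftCoords z j * algebraMap K' K ϖ' ^ (j : ℕ) =
      algebraMap K' K (z (Fin.cast D.finrank_eq j) *
        ϖ' ^ ((Fin.cast D.finrank_eq j : Fin _) : ℕ)) := by
  rw [map_mul, map_pow]
  rfl

lemma hasOrder_lift (D : IsTameLift k₀' k' k₀ k v' v e) {ϖ' : K'}
    {z : Fin (Module.finrank k' K') → K'} {s : ℤ} (hs : HasOrder v' ϖ' z s) :
    HasOrder v (algebraMap K' K ϖ') (D.liftCoords z) (e * s) := by
  constructor
  · intro j
    rw [D.val_liftCoords_mul, ← mul_neg]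
    exact D.ramificationIndex.val_le_of_val_le (hs.1 _)
  · obtain ⟨j, hj⟩ := hs.2
    refine ⟨Fin.cast D.finrank_eq.symm j, ?_⟩
    rw [D.val_liftCoords_mul, ← mul_neg]
    exact D.ramificationIndex.val_of_val hj

lemma zero_notMem_baseChange (D : IsTameLift k₀' k' k₀ k v' v e) {B : Set (GrpAlg k' K')}
    (hB : (0 : GrpAlg k' K') ∉ B) : (0 : GrpAlg k K) ∉ baseChange k K B := by
  rintro ⟨b, hb, h⟩
  have : b = 0 := by
    ext σ
    obtain ⟨τ, rfl⟩ := D.bijective.2 σ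
    have := h τ
    rw [MonoidAlgebra.coeff_zero, Finsupp.zero_apply, eq_comm, map_eq_zero] at this
    rw [this]
    rfl
  exact hB (this ▸ hb)

variable [FiniteDimensional k' K'] [FiniteDimensional k K] [IsGalois k K] [v'.HasExtension v]

/-- Coordinates over `K'` for the elements of a residue class of a base change, and the linear
independence of their leading coefficients. -/
lemma exists_coords_residueClass (D : IsTameLift k₀' k' k₀ k v' v e) {ϖ' : K'}
    (hϖ' : IsUnif v' ϖ') {ϖ : K} (hϖ : IsUnif v ϖ) {B : Set (GrpAlg k' K')}
    (hB : IsGradedIndependent v' k₀' ϖ' B) (s : ℤ) :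
    ∃ (z : residueClass v k₀ (baseChange k K B) s → Fin (Module.finrank k' K') → K')
      (t : residueClass v k₀ (baseChange k K B) s → ℤ),
      (∀ i, HasOrder v' ϖ' (z i) (t i)) ∧
      (∀ i : residueClass v k₀ (baseChange k K B) s,
        IsCoords (algebraMap K' K ϖ') (i : GrpAlg k K) (D.liftCoords (z i))) ∧
      (∀ i, e * t i ≡ s [ZMOD Module.finrank k₀' K']) ∧
      LinearIndependent (Res v) (fun i j => red v
        (D.liftCoords (z i) j * algebraMap K' K ϖ' ^ (j : ℕ) / ϖ ^ (e * t i))) := by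
  have hco1 : IsCoprime (1 : ℤ) (Module.finrank k' K' : ℤ) := isCoprime_one_left
  have hdata : ∀ i : residueClass v k₀ (baseChange k K B) s, ∃ b ∈ B,
      (∀ τ : K ≃ₐ[k] K, (i : GrpAlg k K).coeff τ = algebraMap K' K (b.coeff (restrictGal k' K' τ)))
      ∧ ∃ z t, IsCoords ϖ' b z ∧ HasOrder v' ϖ' z t := by
    rintro ⟨f, ⟨b, hb, hbf⟩, -⟩
    refine ⟨b, hb, hbf, ?_⟩
    obtain ⟨z, hz⟩ := D.totRam'.exists_coords hϖ' hco1 b.coeff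
    have hz0 : z ≠ 0 := by
      rintro rfl
      refine hB.1 ?_
      have : b = 0 := by
        ext σ
        rw [hz]
        simp
      exact this ▸ hb
    obtain ⟨t, ht⟩ := exists_hasOrder (w := v') hϖ'.ne_zero hz0
    exact ⟨z, t, hz, ht⟩
  choose b hbB hbf z t hz ht using hdata
  have hcoords := fun i => D.isCoords_lift (hz i) (hbf i)
  have hmod : ∀ i, e * t i ≡ s [ZMOD Module.finrank k₀' K'] := by
    intro i
    have h1 := i.2.2
    rw [D.baseFinrank_eq, dFun_eq D.totRam D.val_aut (D.val_unif hϖ') D.coprime_finrank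
      (hcoords i) (D.hasOrder_lift (ht i))] at h1
    exact h1
  refine ⟨z, t, ht, hcoords, hmod, ?_⟩
  rcases isEmpty_or_nonempty (residueClass v k₀ (baseChange k K B) s) with hι | ⟨⟨i₀⟩⟩
  · exact linearIndependent_empty_type
  -- Since `e` is invertible modulo `[K' : k₀']`, one residue class over `K` comes from one residue
  -- class over `K'`.
  have hmod' : ∀ i, t i ≡ t i₀ [ZMOD Module.finrank k₀' K'] := by
    intro i
    have h1 := ((hmod i).trans (hmod i₀).symm).dvd
    rw [← mul_sub] at h1
    exact Int.modEq_iff_dvd.2 (D.coprime.symm.dvd_of_dvd_mul_left h1)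
  let G : residueClass v k₀ (baseChange k K B) s → residueClass v' k₀' B (t i₀) := fun i =>
    ⟨b i, hbB i, by
      rw [dFun_eq D.totRam' D.val_aut' hϖ' hco1 (hz i) (ht i)]
      exact hmod' i⟩
  have hG : Function.Injective G := by
    intro i j hij
    have h1 : b i = b j := congrArg Subtype.val hij
    ext τ
    rw [hbf, hbf, h1]
  have hLI := (hB.2 (t i₀)).comp G hG
  have hLI' := (linearIndependent_gp_iff D.totRam' D.val_aut' hϖ' hϖ' hco1 hz ht
    (s₀ := t i₀) fun i => (hmod' i).of_dvd (Int.natCast_dvd_natCast.2 D.finrank_dvd)).1 hLI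
  -- This unit compares the normalisations by the two uniformizers; its reduction is the factor by
  -- which the `i`-th vector is rescaled.
  have hu : ∀ i, v (algebraMap K' K ϖ' ^ t i / ϖ ^ (e * t i)) = 1 := by
    intro i
    rw [map_div₀, map_zpow₀, D.val_unif hϖ', hϖ.val_zpow, ← exp_zsmul, ← exp_sub, ← exp_zero]
    congr 1
    rw [smul_eq_mul]
    ring
  refine linearIndependent_of_baseChange hLI' _
    (fun i => red v (algebraMap K' K ϖ' ^ t i / ϖ ^ (e * t i))) (fun i => ?_)
    (finCongr D.finrank_eq.symm) fun i j => ?_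
  · rw [Ne, red_eq_zero_iff (hu i).le, hu i]
    exact lt_irrefl _
  · have hint : v' (z i j * ϖ' ^ (j : ℕ) / ϖ' ^ t i) ≤ 1 := by
      rw [map_div₀, hϖ'.val_zpow]
      exact div_le_of_le_mul₀ zero_le zero_le (by rw [one_mul]; exact (ht i).1 j)
    have hint' : v (algebraMap K' K (z i j * ϖ' ^ (j : ℕ) / ϖ' ^ t i)) ≤ 1 :=
      (Valuation.HasExtension.val_map_le_one_iff v' v _).2 hint
    rw [← red_algebraMap v' v hint, ← red_mul (hu i).le hint', D.val_liftCoords_mul]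
    congr 1
    have h1 : algebraMap K' K ϖ' ^ t i ≠ 0 := zpow_ne_zero _ (by simpa using hϖ'.ne_zero)
    rw [map_div₀, map_zpow₀]
    field_simp
    rfl

/-- Base change preserves graded independence. -/
theorem isGradedIndependent_baseChange (D : IsTameLift k₀' k' k₀ k v' v e) {ϖ' : K'}
    (hϖ' : IsUnif v' ϖ') {ϖ : K} (hϖ : IsUnif v ϖ) {B : Set (GrpAlg k' K')}
    (hB : IsGradedIndependent v' k₀' ϖ' B) :
    IsGradedIndependent v k₀ ϖ (baseChange k K B) := by
  refine ⟨D.zero_notMem_baseChange hB.1, fun s => ?_⟩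
  obtain ⟨z, t, ht, hz, hmod, hLI⟩ := D.exists_coords_residueClass hϖ' hϖ hB s
  refine (linearIndependent_gp_iff D.totRam D.val_aut hϖ (D.val_unif hϖ') D.coprime_finrank
    hz (fun i => D.hasOrder_lift (ht i)) (s₀ := s) fun i => ?_).2 hLI
  refine (hmod i).of_dvd ?_
  rw [D.finrank_eq]
  exact Int.natCast_dvd_natCast.2 D.finrank_dvd

end IsTameLift

end BaseChange

/-! ### Generation of the group algebra over the base field. -/

section GradedBase

variable {k₀' k' K' k₀ k K : Type*} [Field k₀'] [Field k'] [Field K'] [Field k₀] [Field k] [Field K]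
  [Algebra k' K'] [Algebra k' k] [Algebra k K] [Algebra k' K] [Algebra K' K]
  [IsScalarTower k' k K] [IsScalarTower k' K' K] [Algebra k₀' K'] [Algebra k₀ K]
  [Algebra k₀' K] [IsScalarTower k₀' K' K] [Algebra k₀' k₀] [IsScalarTower k₀' k₀ K]

lemma ext_coeff {f g : GrpAlg k K} (h : ∀ τ, f.coeff τ = g.coeff τ) : f = g := by
  ext τ
  exact h τ

variable [Normal k' K'] [FiniteDimensional k K]

variable (k K) in
/-- The element of `K[Gal(K/k)]` given by an element of `K'[Gal(K'/k')]`. -/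
noncomputable def liftGrpAlg (b : GrpAlg k' K') : GrpAlg k K :=
  MonoidAlgebra.ofCoeff (Finsupp.equivFunOnFinite.symm
    fun τ => algebraMap K' K (b.coeff (restrictGal k' K' τ)))

lemma coeff_liftGrpAlg (b : GrpAlg k' K') (τ : K ≃ₐ[k] K) :
    (liftGrpAlg k K b).coeff τ = algebraMap K' K (b.coeff (restrictGal k' K' τ)) := by
  simp [liftGrpAlg]

lemma mem_baseChange {B : Set (GrpAlg k' K')} {f : GrpAlg k K} :
    f ∈ baseChange k K B ↔ ∃ b ∈ B, f = liftGrpAlg k K b := by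
  refine exists_congr fun b => and_congr_right fun _ => ⟨fun h => ?_, ?_⟩
  · exact ext_coeff fun τ => by rw [h, coeff_liftGrpAlg]
  · rintro rfl
    exact coeff_liftGrpAlg b

lemma liftGrpAlg_mem_span {B : Set (GrpAlg k' K')} {b : GrpAlg k' K'}
    (hb : b ∈ Submodule.span k₀' B) :
    liftGrpAlg k K b ∈ Submodule.span k₀ (baseChange k K B) := by
  induction hb using Submodule.span_induction with
  | mem b hb => exact Submodule.subset_span (mem_baseChange.2 ⟨b, hb, rfl⟩)
  | zero =>
    convert Submodule.zero_mem _
    refine ext_coeff fun τ => ?_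
    rw [coeff_liftGrpAlg]
    simp
  | add x y _ _ hx hy =>
    have : liftGrpAlg k K (x + y) = liftGrpAlg k K x + liftGrpAlg k K y := by
      refine ext_coeff fun τ => ?_
      simp [coeff_liftGrpAlg]
    rw [this]
    exact add_mem hx hy
  | smul c x _ hx =>
    have : liftGrpAlg k K (c • x) = algebraMap k₀' k₀ c • liftGrpAlg k K x := by
      refine ext_coeff fun τ => ?_
      simp only [coeff_liftGrpAlg, MonoidAlgebra.coeff_smul, Finsupp.smul_apply]
      rw [Algebra.smul_def, Algebra.smul_def, map_mul, ← IsScalarTower.algebraMap_apply,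
        ← IsScalarTower.algebraMap_apply]
    rw [this]
    exact Submodule.smul_mem _ _ hx

/-- Group elements lie in the span of `B` over `k₀'`, and lifting is compatible with scalars from
`k₀'`. So the lifted group elements, which generate over `k₀`, lie in the span of the base change.
-/
theorem span_baseChange
    (hbij : Function.Bijective (restrictGal k' K' : (K ≃ₐ[k] K) → (K' ≃ₐ[k'] K')))
    {B : Set (GrpAlg k' K')} (hB : (Submodule.span k₀' B : Set (GrpAlg k' K')) = baseGrpAlg k₀') :
    (Submodule.span k₀ (baseChange k K B) : Set (GrpAlg k K)) = baseGrpAlg k₀ := by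
  classical
  ext f
  constructor
  · intro hf τ
    rw [SetLike.mem_coe] at hf
    induction hf using Submodule.span_induction with
    | mem f hf =>
      obtain ⟨b, hb, hbf⟩ := hf
      have hb' : b ∈ (baseGrpAlg k₀' : Set (GrpAlg k' K')) := hB ▸ Submodule.subset_span hb
      obtain ⟨a, ha⟩ := hb' (restrictGal k' K' τ)
      refine ⟨algebraMap k₀' k₀ a, ?_⟩
      rw [hbf, ← ha, ← IsScalarTower.algebraMap_apply k₀' k₀ K,
        ← IsScalarTower.algebraMap_apply k₀' K' K]
    | zero => exact ⟨0, by simp⟩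
    | add x y _ _ hx hy =>
      obtain ⟨a, ha⟩ := hx
      obtain ⟨b, hb⟩ := hy
      exact ⟨a + b, by simp [ha, hb]⟩
    | smul c x _ hx =>
      obtain ⟨a, ha⟩ := hx
      exact ⟨c * a, by simp [ha, Algebra.smul_def]⟩
  · intro hf
    choose a ha using hf
    have hsingle : ∀ τ : K ≃ₐ[k] K,
        (MonoidAlgebra.single τ 1 : GrpAlg k K) ∈ Submodule.span k₀ (baseChange k K B) := by
      intro τ
      have h1 : (MonoidAlgebra.single τ 1 : GrpAlg k K)
          = liftGrpAlg k K (MonoidAlgebra.single (restrictGal k' K' τ) 1) := by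
        refine ext_coeff fun ρ => ?_
        rw [coeff_liftGrpAlg]
        simp only [MonoidAlgebra.coeff_single, Finsupp.single_apply, hbij.1.eq_iff]
        split_ifs <;> simp
      rw [h1]
      refine liftGrpAlg_mem_span (k₀' := k₀') ?_
      rw [← SetLike.mem_coe, hB]
      intro σ
      simp only [MonoidAlgebra.coeff_single, Finsupp.single_apply]
      split_ifs
      · exact ⟨1, by simp⟩
      · exact ⟨0, by simp⟩
    have hf' : f = ∑ τ, a τ • (MonoidAlgebra.single τ 1 : GrpAlg k K) := by
      refine ext_coeff fun ρ => ?_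
      simp [MonoidAlgebra.coeff_sum, Finsupp.finsetSum_apply, Finsupp.single_apply, ← ha,
        Algebra.smul_def]
    rw [SetLike.mem_coe, hf']
    exact sum_mem fun τ _ => Submodule.smul_mem _ _ (hsingle τ)

end GradedBase

/-! ### Diagonality of linear combinations. -/

section Diagonal

variable {k₀' k' K' k₀ k K : Type*} [Field k₀'] [Field k'] [Field K'] [Field k₀] [Field k] [Field K]
  [Algebra k' K'] [Algebra k' k] [Algebra k K] [Algebra k' K] [Algebra K' K]
  [IsScalarTower k' k K] [IsScalarTower k' K' K] [Algebra k₀' K'] [Algebra k₀ K]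
  {v' : Valuation K' ℤᵐ⁰} {v : Valuation K ℤᵐ⁰} {e : ℕ}
  [IsGalois k' K'] [FiniteDimensional k₀' K']

namespace IsTameLift

/-- An element of `K'` of sufficiently large value is, up to a power of the uniformizing element
and higher order terms, an element of `k₀'`. -/
lemma exists_coord_approx (D : IsTameLift k₀' k' k₀ k v' v e) {ϖ' : K'} (hϖ' : IsUnif v' ϖ')
    {y : K'} {t t₀ q : ℤ} (hy : v' y ≤ exp (-t)) (hq : t₀ - t = Module.finrank k₀' K' * q) :
    ∃ (a : k₀') (δ : K'), y = ϖ' ^ t₀ * (algebraMap k₀' K' a + δ) ∧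
      v' (algebraMap k₀' K' a) ≤ exp (t₀ - t) ∧ v' δ ≤ exp (t₀ - t - 1) := by
  have hx : v' (y * ϖ' ^ (-t₀)) ≤ exp (Module.finrank k₀' K' * q) := by
    rw [map_mul, hϖ'.val_zpow, ← hq, neg_neg]
    calc _ ≤ exp (-t) * exp t₀ := by gcongr
      _ = _ := by rw [← exp_add]; congr 1; ring
  obtain ⟨a, ha, hδ⟩ := D.baseTotRam'.exists_approx hx
  rw [← hq] at ha hδ
  refine ⟨a, y * ϖ' ^ (-t₀) - algebraMap k₀' K' a, ?_, ha, hδ⟩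
  rw [add_sub_cancel, mul_left_comm, ← zpow_add₀ hϖ'.ne_zero, add_neg_cancel, zpow_zero, mul_one]

variable [Algebra k₀' K] [IsScalarTower k₀' K' K] [Algebra k₀' k₀] [IsScalarTower k₀' k₀ K]

/-- The value of a combination of elements of `K'` whose values are congruent modulo `[K' : k₀']`,
with coefficients in `k₀`, is minimal or significantly larger. -/
lemma val_sum_gap (D : IsTameLift k₀' k' k₀ k v' v e) {ϖ' : K'} (hϖ' : IsUnif v' ϖ') {ι : Type*}
    (T : Finset ι) (c : ι → k₀) (y : ι → K') (t : ι → ℤ) (hy : ∀ i ∈ T, v' (y i) ≤ exp (-t i))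
    {i₀ : ι} {m : ℤ} (hm₀ : v (algebraMap k₀ K (c i₀)) = exp (m + e * t i₀))
    (hm : ∀ i ∈ T, v (algebraMap k₀ K (c i)) ≤ exp (m + e * t i))
    (hmod : ∀ i ∈ T, t i ≡ t i₀ [ZMOD Module.finrank k₀' K']) {r : ℤ} (hr : r ≤ e)
    (hr' : r ≤ Module.finrank k₀' K')
    (hne : v (∑ i ∈ T, algebraMap k₀ K (c i) * algebraMap K' K (y i)) ≠ exp m) :
    v (∑ i ∈ T, algebraMap k₀ K (c i) * algebraMap K' K (y i)) ≤ exp (m - r) := by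
  classical
  have hdata : ∀ i, ∃ (a : k₀') (δ : K'), i ∈ T → y i = ϖ' ^ t i₀ * (algebraMap k₀' K' a + δ) ∧
      v' (algebraMap k₀' K' a) ≤ exp (t i₀ - t i) ∧ v' δ ≤ exp (t i₀ - t i - 1) := by
    intro i
    by_cases hi : i ∈ T
    · obtain ⟨q, hq⟩ := (hmod i hi).dvd
      obtain ⟨a, δ, h⟩ := D.exists_coord_approx hϖ' (hy i hi) hq
      exact ⟨a, δ, fun _ => h⟩
    · exact ⟨0, 0, fun h => absurd h hi⟩
  choose a δ had using hdata
  set θ := algebraMap K' K ϖ' with hθ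
  have hvθ : v (θ ^ t i₀) = exp (-(e * t i₀)) := by
    rw [map_zpow₀, D.val_unif hϖ', ← exp_zsmul, smul_eq_mul]
    congr 1
    ring
  -- Main part and error: `Y` lies in `k₀`, so its values are restricted to multiples of the degree,
  -- while a gain of one in `K'` makes `Δ` smaller by `e` in `K`.
  let Y : k₀ := ∑ i ∈ T, c i * algebraMap k₀' k₀ (a i)
  let Δ : K := ∑ i ∈ T, algebraMap k₀ K (c i) * algebraMap K' K (δ i)
  have hsum : ∑ i ∈ T, algebraMap k₀ K (c i) * algebraMap K' K (y i)
      = θ ^ t i₀ * (algebraMap k₀ K Y + Δ) := by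
    simp only [Y, Δ, map_sum, ← Finset.sum_add_distrib, Finset.mul_sum]
    refine Finset.sum_congr rfl fun i hi => ?_
    rw [(had i hi).1, map_mul, map_mul, map_add, map_zpow₀,
      ← IsScalarTower.algebraMap_apply k₀' K' K, ← IsScalarTower.algebraMap_apply k₀' k₀ K]
    ring
  set M := m + e * t i₀ with hM
  have hΔ : v Δ ≤ exp (M - e) := by
    refine v.map_sum_le fun i hi => ?_
    rw [map_mul]
    calc _ ≤ exp (m + e * t i) * exp (e * (t i₀ - t i - 1)) := by
          gcongr
          · exact hm i hi
          · exact D.ramificationIndex.val_le_of_val_le (had i hi).2.2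
      _ = _ := by rw [← exp_add]; congr 1; rw [hM]; ring
  have hY : v (algebraMap k₀ K Y) ≤ exp M := by
    simp only [Y, map_sum]
    refine v.map_sum_le fun i hi => ?_
    rw [map_mul, map_mul, ← IsScalarTower.algebraMap_apply k₀' k₀ K,
      IsScalarTower.algebraMap_apply k₀' K' K]
    calc _ ≤ exp (m + e * t i) * exp (e * (t i₀ - t i)) := by
          gcongr
          · exact hm i hi
          · exact D.ramificationIndex.val_le_of_val_le (had i hi).2.1
      _ = _ := by rw [← exp_add]; congr 1; rw [hM]; ring
  have he : (0 : ℤ) < e := by exact_mod_cast D.ramificationIndex.1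
  have hθmul : ∀ i : ℤ, exp (-(e * t i₀)) * exp (M - i) = exp (m - i) := by
    intro i
    rw [← exp_add]
    congr 1
    rw [hM]
    ring
  rw [hsum, map_mul, hvθ] at hne ⊢
  have hYne : v (algebraMap k₀ K Y) ≠ exp M := by
    intro hYM
    refine hne ?_
    rw [v.map_add_eq_of_lt_left, hYM]
    · simpa using hθmul 0
    · rw [hYM]
      refine hΔ.trans_lt ?_
      rw [exp_lt_exp]
      omega
  -- The bound `M` is itself the value of the element `c i₀` of `k₀`, so a value of `Y` different
  -- from `M` drops by at least the full degree.
  have hY' : v (algebraMap k₀ K Y) ≤ exp (M - Module.finrank k₀' K') := by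
    rcases eq_or_ne Y 0 with h0 | h0
    · simp [h0]
    have h1 := exp_log_of_val_ne v (x := algebraMap k₀ K Y) (by simpa using h0)
    have h2 := D.baseTotRam.dvd_of_val_eq h1
    have h3 := D.baseTotRam.dvd_of_val_eq hm₀
    rw [D.baseFinrank_eq] at h2 h3
    rw [h1, exp_le_exp] at hY ⊢
    rw [h1, Ne, exp_inj] at hYne
    have h4 := Int.le_of_dvd (by omega) (h3.sub h2)
    omega
  rw [← hθmul r]
  gcongr
  refine v.map_add_le (hY'.trans ?_) (hΔ.trans ?_) <;>
  · rw [exp_le_exp]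
    omega

theorem isDiagonal_of_mem_span [FiniteDimensional k' K'] [FiniteDimensional k K] [IsGalois k K]
    [v'.HasExtension v] (D : IsTameLift k₀' k' k₀ k v' v e) {ϖ' : K'}
    (hϖ' : IsUnif v' ϖ') {ϖ : K} (hϖ : IsUnif v ϖ)
    (hne : Module.finrank k' K' ≤ e + 1) {B : Set (GrpAlg k' K')}
    (hB : IsGradedIndependent v' k₀' ϖ' B) (s : ℤ) {f : GrpAlg k K}
    (hf : f ∈ Submodule.span k₀ (residueClass v k₀ (baseChange k K B) s)) (hf0 : f ≠ 0) :
    IsDiagonal v ϖ f := by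
  classical
  obtain ⟨z, t, ht, hz, hmod, hLI⟩ := D.exists_coords_residueClass hϖ' hϖ hB s
  obtain ⟨l, hl⟩ := (Finsupp.mem_span_iff_linearCombination k₀ _ f).1 hf
  set θ := algebraMap K' K ϖ' with hθ
  have hvθ := D.val_unif hϖ'
  have hT : l.support.Nonempty := by
    rw [Finset.nonempty_iff_ne_empty, Ne, Finsupp.support_eq_empty]
    rintro rfl
    rw [map_zero] at hl
    exact hf0 hl.symm
  -- coordinates of `f`
  let x : Fin (Module.finrank k K) → K := fun j =>
    ∑ i ∈ l.support, algebraMap k₀ K (l i) * D.liftCoords (z i) j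
  have hx : IsCoords θ f x := by
    intro τ
    rw [← hl, Finsupp.linearCombination_apply, Finsupp.sum, MonoidAlgebra.coeff_sum,
      Finsupp.finsetSum_apply]
    simp only [x, Finset.sum_mul]
    rw [Finset.sum_comm]
    refine Finset.sum_congr rfl fun i _ => ?_
    rw [MonoidAlgebra.coeff_smul_apply, hz i τ, Algebra.smul_def, Finset.mul_sum]
    simp only [mul_assoc]
  obtain ⟨i₀, hi₀, hmax⟩ := l.support.exists_max_image
    (fun i => log (v (algebraMap k₀ K (l i))) - e * t i) hT
  -- By the choice of `i₀`, `exp m` bounds every term of every coordinate.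
  set m := log (v (algebraMap k₀ K (l i₀))) - e * t i₀ with hm
  have hval : ∀ i ∈ l.support, v (algebraMap k₀ K (l i)) = exp (log (v (algebraMap k₀ K (l i)))) :=
    fun i hi => exp_log_of_val_ne v (by simpa using hi)
  have hm₀ : v (algebraMap k₀ K (l i₀)) = exp (m + e * t i₀) := by
    rw [hval i₀ hi₀, hm, sub_add_cancel]
  have hmle : ∀ i ∈ l.support, v (algebraMap k₀ K (l i)) ≤ exp (m + e * t i) := by
    intro i hi
    rw [hval i hi, exp_le_exp]
    have := hmax i hi
    linarith
  have hmod' : ∀ i ∈ l.support, t i ≡ t i₀ [ZMOD Module.finrank k₀' K'] := by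
    intro i _
    have h1 := ((hmod i).trans (hmod i₀).symm).dvd
    rw [← mul_sub] at h1
    exact Int.modEq_iff_dvd.2 (D.coprime.symm.dvd_of_dvd_mul_left h1)
  have hterm : ∀ j, x j * θ ^ (j : ℕ) = ∑ i ∈ l.support, algebraMap k₀ K (l i) * algebraMap K' K
      (z i (Fin.cast D.finrank_eq j) * ϖ' ^ ((Fin.cast D.finrank_eq j : Fin _) : ℕ)) := by
    intro j
    simp only [x, Finset.sum_mul, mul_assoc, hθ, D.val_liftCoords_mul]
  have hle : ∀ j, v (x j * θ ^ (j : ℕ)) ≤ exp m := by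
    intro j
    rw [hterm]
    refine v.map_sum_le fun i hi => ?_
    rw [map_mul]
    calc _ ≤ exp (m + e * t i) * exp (e * (-t i)) := by
          gcongr
          · exact hmle i hi
          · exact D.ramificationIndex.val_le_of_val_le ((ht i).1 _)
      _ = _ := by rw [← exp_add]; congr 1; ring
  have hNn : Module.finrank k' K' ≤ Module.finrank k₀' K' :=
    Nat.le_of_dvd Module.finrank_pos D.finrank_dvd
  -- Here `r = n - 1`, which is at most `e` by assumption and at most `[K' : k₀']` since `n` divides
  -- that degree.
  have hgap : ∀ j, v (x j * θ ^ (j : ℕ)) ≠ exp m →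
      v (x j * θ ^ (j : ℕ)) ≤ exp (m - (Module.finrank k K - 1)) := by
    intro j hj
    rw [hterm] at hj ⊢
    refine D.val_sum_gap hϖ' l.support _ _ t (fun i _ => (ht i).1 _) hm₀ hmle hmod' ?_ ?_ hj
    · rw [D.finrank_eq]; omega
    · rw [D.finrank_eq]; omega
  have hex : ∃ j, v (x j * θ ^ (j : ℕ)) = exp m := by
    -- If no coordinate attained the bound, reduction would give a linear relation between the
    -- leading vectors, with nonzero coefficient at `i₀`.
    by_contra hcon
    push Not at hcon
    have hu : ∀ i ∈ l.support, v (algebraMap k₀ K (l i) * ϖ ^ (e * t i + m)) ≤ 1 := by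
      intro i hi
      rw [map_mul, hϖ.val_zpow]
      calc _ ≤ exp (m + e * t i) * exp (-(e * t i + m)) := by
            gcongr
            exact hmle i hi
        _ = 1 := by rw [← exp_add, ← exp_zero]; congr 1; ring
    have hu₀ : v (algebraMap k₀ K (l i₀) * ϖ ^ (e * t i₀ + m)) = 1 := by
      rw [map_mul, hϖ.val_zpow, hm₀, ← exp_add, ← exp_zero]
      congr 1
      ring
    have hw : ∀ i j, v (D.liftCoords (z i) j * θ ^ (j : ℕ) / ϖ ^ (e * t i)) ≤ 1 := by
      intro i j
      rw [map_div₀, hϖ.val_zpow]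
      exact div_le_of_le_mul₀ zero_le zero_le (by
        rw [one_mul]; exact (D.hasOrder_lift (ht i)).1 j)
    have hrel : ∑ i ∈ l.support, red v (algebraMap k₀ K (l i) * ϖ ^ (e * t i + m)) •
        (fun j => red v (D.liftCoords (z i) j * θ ^ (j : ℕ) / ϖ ^ (e * t i))) = 0 := by
      ext j
      rw [Finset.sum_apply, Pi.zero_apply]
      have h1 : ∀ i ∈ l.support, v (algebraMap k₀ K (l i) * ϖ ^ (e * t i + m) *
          (D.liftCoords (z i) j * θ ^ (j : ℕ) / ϖ ^ (e * t i))) ≤ 1 := by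
        intro i hi
        rw [map_mul]
        exact mul_le_one' (hu i hi) (hw i j)
      have h2 : ∑ i ∈ l.support, algebraMap k₀ K (l i) * ϖ ^ (e * t i + m) *
          (D.liftCoords (z i) j * θ ^ (j : ℕ) / ϖ ^ (e * t i)) = x j * θ ^ (j : ℕ) * ϖ ^ m := by
        simp only [x, Finset.sum_mul]
        refine Finset.sum_congr rfl fun i _ => ?_
        rw [zpow_add₀ hϖ.ne_zero]
        have h3 : ϖ ^ (e * t i) ≠ 0 := zpow_ne_zero _ hϖ.ne_zero
        field_simp
      have h4 : v (x j * θ ^ (j : ℕ) * ϖ ^ m) < 1 := by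
        rw [map_mul, hϖ.val_zpow]
        calc _ < exp m * exp (-m) := by
              gcongr
              · exact exp_pos
              · exact lt_of_le_of_ne (hle j) (hcon j)
          _ = 1 := by rw [← exp_add, add_neg_cancel, exp_zero]
      have h5 := red_sum l.support _ h1
      rw [h2, (red_eq_zero_iff h4.le).2 h4] at h5
      rw [h5]
      refine Finset.sum_congr rfl fun i hi => ?_
      rw [red_mul (hu i hi) (hw i j)]
      rfl
    have h6 := linearIndependent_iff'.1 hLI l.support _ hrel i₀ hi₀
    rw [red_eq_zero_iff hu₀.le, hu₀] at h6
    exact lt_irrefl _ h6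
  refine isDiagonal_of_gap D.totRam D.val_aut hϖ hvθ D.coprime_finrank hx (s := -m)
    ⟨fun j => ?_, ?_⟩ fun j hj => ?_
  · rw [neg_neg]; exact hle j
  · rw [neg_neg]; exact hex
  · rw [neg_neg] at hj
    convert hgap j hj using 2
    ring

end IsTameLift

end Diagonal

end TameLift

theorem mainTheorem5
    {k₀' k' K' k₀ k K : Type*} [Field k₀'] [Field k'] [Field K'] [Field k₀] [Field k] [Field K]
    -- the fields `k₀' ⊆ k' ⊆ K' ⊆ K`, `k₀' ⊆ k₀ ⊆ k ⊆ K` and `k' ⊆ k`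
    [Algebra k₀' k'] [Algebra k' K'] [Algebra k₀' K'] [IsScalarTower k₀' k' K']
    [Algebra K' K] [Algebra k₀' K] [IsScalarTower k₀' K' K]
    [Algebra k₀' k₀] [Algebra k₀ K] [IsScalarTower k₀' k₀ K]
    [Algebra k₀ k] [Algebra k K] [IsScalarTower k₀ k K]
    [Algebra k' k] [Algebra k' K] [IsScalarTower k' k K] [IsScalarTower k' K' K]
    -- `k = k₀ k'` and `K = k₀ K'`
    (hk : IntermediateField.adjoin k₀ (Set.range (algebraMap k' k)) = ⊤)
    (hK : IntermediateField.adjoin k₀ (Set.range (algebraMap K' K)) = ⊤)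
    -- the normalised valuations of `k₀'`, `K'`, `k₀` and `K`
    (v₀' : Valuation k₀' ℤᵐ⁰) (v' : Valuation K' ℤᵐ⁰) (v₀ : Valuation k₀ ℤᵐ⁰) (v : Valuation K ℤᵐ⁰)
    (hv₀' : TameLift.IsCompleteDVF v₀') (hv' : Function.Surjective v')
    (hv₀ : Function.Surjective v₀) (hv : Function.Surjective v)
    [v₀'.HasExtension v₀] [v'.HasExtension v]
    -- `p` is the residue characteristic
    (p : ℕ) (hp : p.Prime) [CharP (IsLocalRing.ResidueField v₀'.valuationSubring) p]
    -- `K'/k₀'` is totally ramified and its degree is a power of `p`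
    (hram : TameLift.IsTotallyRamified v₀' v') (hdeg : ∃ r : ℕ, Module.finrank k₀' K' = p ^ r)
    -- `K'/k'` is a Galois extension of degree `n`
    [IsGalois k' K'] (n : ℕ) (hn : Module.finrank k' K' = n)
    -- `k₀/k₀'` is tamely ramified of ramification index `e`
    (e : ℕ) (htame : TameLift.IsTamelyRamified p v₀' v₀ e)
    -- the fixed uniformizing elements of `K'` and `K`
    (ϖ' : K') (hϖ' : TameLift.IsUnif v' ϖ') (ϖ : K) (hϖ : TameLift.IsUnif v ϖ) :
    -- linear disjointness
    IntermediateField.LinearDisjoint (IsScalarTower.toAlgHom k₀' K' K).fieldRange k₀ ∧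
    -- `K/k` is a Galois extension whose group is identified with `G = Gal(K'/k')` by restriction
    (IsGalois k K ∧ Function.Bijective
      (TameLift.restrictGal k' K' : (K ≃ₐ[k] K) → (K' ≃ₐ[k'] K'))) ∧
    -- graded independent sets and graded bases are preserved
    (∀ B : Set (TameLift.GrpAlg k' K'), TameLift.IsGradedIndependent v' k₀' ϖ' B →
      TameLift.IsGradedIndependent v k₀ ϖ (TameLift.baseChange k K B)) ∧
    (∀ B : Set (TameLift.GrpAlg k' K'), TameLift.IsGradedBase v' k₀' ϖ' B →
      TameLift.IsGradedBase v k₀ ϖ (TameLift.baseChange k K B)) ∧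
    -- graded independent sets become diagonal when `e ≥ n - 1`
    (n ≤ e + 1 → ∀ B : Set (TameLift.GrpAlg k' K'), TameLift.IsGradedIndependent v' k₀' ϖ' B →
      TameLift.IsDiagonalSet v k₀ ϖ (TameLift.baseChange k K B)) := by
  classical
  obtain ⟨hfin', hramN⟩ := hram
  obtain ⟨hfin₀, hramE, hpe, -⟩ := htame
  obtain ⟨r, hr⟩ := hdeg
  have hcop : Nat.Coprime e (Module.finrank k₀' K') := by
    rw [hr]
    exact ((Nat.coprime_comm.1 ((hp.coprime_iff_not_dvd).2 hpe))).pow_right r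
  -- the towers of fields
  have hfk' : FiniteDimensional k' K' := FiniteDimensional.right k₀' k' K'
  have hfk₀' : FiniteDimensional k₀' k' := FiniteDimensional.left k₀' k' K'
  obtain ⟨hfK, hN, hE, hv₀v⟩ := TameLift.tame_composite hK hv₀' hv' hv₀ hv hramN hramE hcop
  have hfk : FiniteDimensional k K := FiniteDimensional.right k₀ k K
  have hfk₀ : FiniteDimensional k₀ k := FiniteDimensional.left k₀ k K
  have hKk : IntermediateField.adjoin k (Set.range (algebraMap K' K)) = ⊤ := by
    rw [eq_top_iff]
    intro x _
    have hx : x ∈ IntermediateField.adjoin k₀ (Set.range (algebraMap K' K)) := by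
      rw [hK]; exact IntermediateField.mem_top
    have hle : IntermediateField.adjoin k₀ (Set.range (algebraMap K' K)) ≤
        (IntermediateField.adjoin k (Set.range (algebraMap K' K))).restrictScalars k₀ :=
      IntermediateField.adjoin_le_iff.2 (IntermediateField.subset_adjoin k _)
    exact hle hx
  have h1 := (TameLift.finrank_le_of_adjoin (F' := k') hKk).2
  have h2 : Module.finrank k₀ k ≤ Module.finrank k₀' k' := by
    -- The inclusion of `k₀'` in `k` is defined through `k₀`; its agreement with the one through
    -- `k'` is checked inside `K`.
    let _ : Algebra k₀' k := ((algebraMap k₀ k).comp (algebraMap k₀' k₀)).toAlgebra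
    have _ : IsScalarTower k₀' k₀ k := IsScalarTower.of_algebraMap_eq' rfl
    have _ : IsScalarTower k₀' k' k := by
      refine IsScalarTower.of_algebraMap_eq fun x => (algebraMap k K).injective ?_
      rw [IsScalarTower.algebraMap_apply k₀' k₀ k, ← IsScalarTower.algebraMap_apply k₀ k K,
        ← IsScalarTower.algebraMap_apply k₀' k₀ K, ← IsScalarTower.algebraMap_apply k' k K,
        IsScalarTower.algebraMap_apply k' K' K, ← IsScalarTower.algebraMap_apply k₀' k' K',
        ← IsScalarTower.algebraMap_apply k₀' K' K]
    exact (TameLift.finrank_le_of_adjoin (F' := k₀') hk).2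
  have h3 := Module.finrank_mul_finrank k₀ k K
  have h4 := Module.finrank_mul_finrank k₀' k' K'
  have hfr : Module.finrank k K = Module.finrank k' K' := by
    -- The products of degrees along the two towers agree and each factor over `k₀` is bounded by
    -- its counterpart over `k₀'`, so the factors agree.
    refine le_antisymm h1 ?_
    by_contra hlt
    push Not at hlt
    have hpos : 0 < Module.finrank k₀' k' := Module.finrank_pos
    have h5 := Nat.mul_lt_mul_of_le_of_lt h2 hlt hpos
    omega
  have hgal : IsGalois k K := TameLift.isGalois_composite (k' := k') hKk
  have hbij := TameLift.restrictGal_bijective (k' := k') hKk hfr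
  have hbase' : TameLift.TotRam k₀' v' := ⟨hv', hramN.valGroup_eq hv₀'.surjective⟩
  have hbase : TameLift.TotRam k₀ v := ⟨hv, by rw [hN]; exact hv₀v.valGroup_eq hv₀⟩
  have hNE := hramN.trans hE
  have hfin : FiniteDimensional k₀' K := FiniteDimensional.trans k₀' k₀ K
  have D : TameLift.IsTameLift k₀' k' k₀ k v' v e :=
    { totRam' := ⟨hv', TameLift.valGroup_eq_zmultiples_of_tower hv' hbase'.valGroup_eq⟩
      totRam := ⟨hv, TameLift.valGroup_eq_zmultiples_of_tower hv hbase.valGroup_eq⟩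
      baseTotRam' := hbase'
      baseTotRam := hbase
      -- Automorphisms over `k'` or `k` also fix the complete field `k₀'`, over which uniqueness is
      -- available.
      val_aut' := fun σ x => TameLift.val_map_eq_of_extends hv₀' hramN σ.toRingEquiv.toRingHom
        (fun a => by
          rw [IsScalarTower.algebraMap_apply k₀' k' K']
          exact σ.commutes _) x
      val_aut := fun σ x => TameLift.val_map_eq_of_extends hv₀' hNE σ.toRingEquiv.toRingHom
        (fun a => by
          rw [IsScalarTower.algebraMap_apply k₀' k₀ K, IsScalarTower.algebraMap_apply k₀ k K]
          exact σ.commutes _) x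
      ramificationIndex := hE
      coprime := Nat.isCoprime_iff_coprime.2 hcop
      finrank_eq := hfr
      baseFinrank_eq := hN
      finrank_dvd := ⟨_, by rw [mul_comm]; exact h4.symm⟩
      bijective := hbij }
  refine ⟨TameLift.linearDisjoint_of_finrank_eq hK hN, ⟨hgal, hbij⟩, fun B hB => ?_,
    fun B hB => ⟨?_, ?_⟩, fun hne B hB => ⟨?_, fun s f hf hf0 => ?_⟩⟩
  · exact D.isGradedIndependent_baseChange hϖ' hϖ hB
  · exact D.isGradedIndependent_baseChange hϖ' hϖ hB.1
  · exact TameLift.span_baseChange hbij hB.2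
  · exact D.isGradedIndependent_baseChange hϖ' hϖ hB
  · exact D.isDiagonal_of_mem_span hϖ' hϖ (hn ▸ hne) hB s hf hf0
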